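/- All rings are commutative with identity and all sequences are finite. Let $R$ be a ring, $M$ an $R$-module and $\mathbf x=x_1,\dots,x_\ell$ a sequence in $R$. The sequence $\mathbf x$ is a \emph{weak $M$-regular sequence} if $x_i$ is a non-zero-divisor on $M/(x_1,\dots,x_{i-1})M$ for $i=1,\dots,\ell$; it is \emph{$M$-regular} if moreover $\mathbf xM\neq M$ (the empty sequence is regarded as regular on every module). For $n\ge 0$ write $\mathbf x^n=x_1^n,\dots,x_\ell^n$, and let $H_i(\mathbf x^n,M)$ be the homology of the Koszul complex $K_\bullet(\mathbf x^n,M)$. For $m\ge n$ let $\varphi^m_n:K_\bullet(\mathbf x^m,M)\to K_\bullet(\mathbf x^n,M)$ be the tensor product over $j=1,\dots,\ell$ of the chain maps from $0\to M\xrightarrow{x_j^m}M\to0$ to $0\to M\xrightarrow{x_j^n}M\to0$ given by multiplication by $x_j^{m-n}$ in degree $1$ and by the identity in degree $0$ (so in degree $i$, on the summand $M e_{j_1}\wedge\cdots\wedge e_{j_i}$, it is multiplication by $(x_{j_1}\cdots x_{j_i})^{m-n}$). The sequence $\mathbf x$ is \emph{$M$-weakly proregular} if for each $n$ there is $m\ge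 n$ such that $\varphi^m_n$ induces the zero map $H_i(\mathbf x^m,M)\to H_i(\mathbf x^n,M)$ for all $i\ge1$. Let $H^i_{\mathbf x}(M)$ be the $i$th cohomology of the \v{C}ech complex of $M$ with respect to $\mathbf x$. The sequence $\mathbf x$ is a \emph{parameter sequence on $M$} if it is $M$-weakly proregular, $\mathbf xM\ne M$, and $H^{\ell}_{\mathbf x}(M)_{\mathfrak p}\neq0$ for every prime $\mathfrak p\in\operatorname{Supp}_R(M/\mathbf xM)$; it is a \emph{strong parameter sequence on $M$} if $x_1,\dots,x_i$ is a parameter sequence on $M$ for $i=1,\dots,\ell$. A ring $S$ is \emph{Cohen--Macaulay} (in the sense of Hamilton and Marley) if every strong parameter sequence on $S$ is an $S$-regular sequence. The \emph{trivial extension} $R\ltimes M$ is the ring $R\oplus M$ with multiplication $(r,m)(r',m')=(rr',rm'+r'm)$. \textbf{Theorem.} Let $R$ be a ring and $M$ an $R$-module. \begin{enumerate} \item If every $R$-weakly proregular sequence is $M$-weakly proregular, then $R\ltimes M$ is Cohen--Macaulay if and only if $R$ is Cohen--Macaulay and every $R$-regular sequence is a weak $M$-regular sequence. \item Without any assumption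 on weakly proregular sequences: if $R$ is Cohen--Macaulay and every $R$-regular sequence is a weak $M$-regular sequence, then $R\ltimes M$ is Cohen--Macaulay. \end{enumerate} -/

import Mathlib

open CategoryTheory

universe u v

noncomputable section

namespace HamiltonMarley

/-- The subsets of `{1, …, ℓ}` with exactly `i` elements. -/
abbrev Subsets (ℓ i : ℕ) : Type := {s : Finset (Fin ℓ) // s.card = i}

/-- The sign `(-1) ^ #{k ∈ s | k < j}`. -/
def sgn (R : Type u) [CommRing R] {ℓ : ℕ} (j : Fin ℓ) (s : Finset (Fin ℓ)) : R :=
  (-1) ^ (s.filter (· < j)).card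

section Signs

variable (R : Type u) [CommRing R] {ℓ : ℕ}

theorem sgn_insert {j k : Fin ℓ} {s : Finset (Fin ℓ)} (hk : k ∉ s) :
    sgn R j (insert k s) = if k < j then -sgn R j s else sgn R j s := by
  unfold sgn
  rw [Finset.filter_insert]
  split_ifs with h
  · rw [Finset.card_insert_of_notMem (by simp [hk]), pow_succ]; ring
  · rfl

theorem sgn_swap {j k : Fin ℓ} {s : Finset (Fin ℓ)} (hjk : j ≠ k) (hj : j ∉ s) (hk : k ∉ s) :
    sgn R j s * sgn R k (insert j s) = -(sgn R k s * sgn R j (insert k s)) := by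
  rw [sgn_insert R hj, sgn_insert R hk]
  rcases lt_or_gt_of_ne hjk with h | h
  · rw [if_pos h, if_neg h.not_gt]; ring
  · rw [if_neg h.not_gt, if_pos h]; ring

theorem sgn_erase (j : Fin ℓ) (t : Finset (Fin ℓ)) : sgn R j (t.erase j) = sgn R j t := by
  unfold sgn
  congr 2
  ext k
  simp only [Finset.mem_filter, Finset.mem_erase]
  exact ⟨fun h => ⟨h.1.2, h.2⟩, fun h => ⟨⟨h.2.ne, h.1⟩, h.2⟩⟩

end Signs

/-! ### The Koszul complex -/

section Koszul

variable {R : Type u} [CommRing R] (M : Type v) [AddCommGroup M] [Module R M] {ℓ : ℕ}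

/-- The Koszul differential `K_{i+1}(x, M) → K_i(x, M)`, where `K_i(x, M)` is the direct sum of
copies of `M` with basis symbols `e_s`, `s` an `i`-element subset of `{1, …, ℓ}`; it sends
`m e_t` to `∑_{j ∈ t} (-1) ^ #{k ∈ t | k < j} x_j m e_{t ∖ j}`. -/
def koszulD (x : Fin ℓ → R) (i : ℕ) : (Subsets ℓ (i + 1) → M) →ₗ[R] (Subsets ℓ i → M) where
  toFun f s := ∑ j, if h : j ∈ s.1 then 0 else
    sgn R j s.1 • x j • f ⟨insert j s.1, by rw [Finset.card_insert_of_notMem h, s.2]⟩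
  map_add' f g := by
    ext s
    simp only [Pi.add_apply, ← Finset.sum_add_distrib]
    refine Finset.sum_congr rfl fun j _ => ?_
    split_ifs <;> simp
  map_smul' r f := by
    ext s
    simp only [Pi.smul_apply, RingHom.id_apply, Finset.smul_sum]
    refine Finset.sum_congr rfl fun j _ => ?_
    split_ifs
    · simp
    · rw [smul_comm (x j) r, smul_comm (sgn R j s.1) r]

theorem koszulD_apply (x : Fin ℓ → R) (i : ℕ) (f : Subsets ℓ (i + 1) → M) (s : Subsets ℓ i) :
    koszulD M x i f s = ∑ j, if h : j ∈ s.1 then 0 else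
      sgn R j s.1 • x j • f ⟨insert j s.1, by rw [Finset.card_insert_of_notMem h, s.2]⟩ := rfl

theorem koszulD_comp (x : Fin ℓ → R) (i : ℕ) :
    koszulD M x i ∘ₗ koszulD M x (i + 1) = 0 := by
  refine LinearMap.ext fun f => funext fun s => ?_
  let F : Fin ℓ → Fin ℓ → M := fun j k =>
    if h : j ∉ s.1 ∧ k ∉ s.1 ∧ j ≠ k then
      (sgn R j s.1 * sgn R k (insert j s.1)) • (x j * x k) • f ⟨insert k (insert j s.1), by
        rw [Finset.card_insert_of_notMem (by simp [h.2.1, Ne.symm h.2.2]),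
          Finset.card_insert_of_notMem h.1, s.2]⟩
    else 0
  have hF : ∀ j k, F j k + F k j = 0 := by
    intro j k
    by_cases h : j ∉ s.1 ∧ k ∉ s.1 ∧ j ≠ k
    · have h' : k ∉ s.1 ∧ j ∉ s.1 ∧ k ≠ j := ⟨h.2.1, h.1, h.2.2.symm⟩
      simp only [F, dif_pos h, dif_pos h']
      rw [sgn_swap R h.2.2 h.1 h.2.1, mul_comm (x j) (x k), neg_smul]
      have : insert k (insert j s.1) = insert j (insert k s.1) := Finset.insert_comm _ _ _
      simp only [this, neg_add_cancel]
    · have h' : ¬ (k ∉ s.1 ∧ j ∉ s.1 ∧ k ≠ j) := fun h' => h ⟨h'.2.1, h'.1, h'.2.2.symm⟩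
      simp only [F, dif_neg h, dif_neg h', add_zero]
  have key : (koszulD M x i (koszulD M x (i + 1) f)) s = ∑ p : Fin ℓ × Fin ℓ, F p.1 p.2 := by
    rw [koszulD_apply, Fintype.sum_prod_type]
    refine Finset.sum_congr rfl fun j _ => ?_
    by_cases hj : j ∈ s.1
    · rw [dif_pos hj, Finset.sum_eq_zero]
      intro k _
      exact dif_neg fun h => h.1 hj
    · rw [dif_neg hj, koszulD_apply, Finset.smul_sum, Finset.smul_sum]
      refine Finset.sum_congr rfl fun k _ => ?_
      by_cases hk : k ∈ insert j s.1
      · rw [dif_pos hk, smul_zero, smul_zero]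
        symm
        refine dif_neg fun h => ?_
        rcases Finset.mem_insert.1 hk with h1 | h1
        · exact h.2.2 h1.symm
        · exact h.2.1 h1
      · have h1 : k ≠ j ∧ k ∉ s.1 := by simpa using hk
        rw [dif_neg hk]
        simp only [F, dif_pos (show j ∉ s.1 ∧ k ∉ s.1 ∧ j ≠ k from ⟨hj, h1.2, h1.1.symm⟩)]
        simp only [smul_smul]
        congr 1
        ring
  rw [LinearMap.comp_apply, key]
  refine Finset.sum_involution (fun p _ => p.swap) (fun p _ => hF p.1 p.2) ?_
    (fun _ _ => Finset.mem_univ _) (fun p _ => p.swap_swap)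
  rintro ⟨j, k⟩ _ h1 h2
  obtain rfl : k = j := congrArg Prod.fst h2
  exact h1 (dif_neg fun h => h.2.2 rfl)

/-- The Koszul complex `K_•(x, M)`. -/
def koszulComplex (x : Fin ℓ → R) : ChainComplex (ModuleCat.{v} R) ℕ :=
  ChainComplex.of (fun i => ModuleCat.of R (Subsets ℓ i → M))
    (fun i => ModuleCat.ofHom (koszulD M x i))
    (fun i => by rw [← ModuleCat.ofHom_comp, koszulD_comp]; rfl)

/-- If `a j = c j * b j` for all `j`, the tensor product of the chain maps
`(M --a j--> M) ⟶ (M --b j--> M)` given by `c j` in degree one and by the identity in degree zero;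
in degree `i` it multiplies the `s`-component by `∏ j ∈ s, c j`. -/
def koszulScale (c : Fin ℓ → R) (i : ℕ) : (Subsets ℓ i → M) →ₗ[R] (Subsets ℓ i → M) where
  toFun f s := (∏ j ∈ s.1, c j) • f s
  map_add' f g := by ext s; simp
  map_smul' r f := by ext s; exact smul_comm _ r (f s)

theorem koszulScale_comm {a b c : Fin ℓ → R} (h : ∀ j, c j * b j = a j) (i : ℕ) :
    koszulD M b i ∘ₗ koszulScale M c (i + 1) = koszulScale M c i ∘ₗ koszulD M a i := by
  refine LinearMap.ext fun f => funext fun s => ?_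
  change koszulD M b i (koszulScale M c (i + 1) f) s = (∏ j ∈ s.1, c j) • koszulD M a i f s
  rw [koszulD_apply, koszulD_apply, Finset.smul_sum]
  refine Finset.sum_congr rfl fun j _ => ?_
  split_ifs with hj
  · simp
  · change sgn R j s.1 • b j • (∏ k ∈ insert j s.1, c k) • f _ = _
    rw [Finset.prod_insert hj, ← h j]
    simp only [smul_smul]
    congr 1
    ring

/-- The chain map `K_•(a, M) ⟶ K_•(b, M)` with components `koszulScale`. -/
def koszulMap {a b c : Fin ℓ → R} (h : ∀ j, c j * b j = a j) :
    koszulComplex M a ⟶ koszulComplex M b where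
  f i := ModuleCat.ofHom (koszulScale M c i)
  comm' i j hij := by
    obtain rfl : j + 1 = i := hij
    have hd (y : Fin ℓ → R) : (koszulComplex M y).d (j + 1) j = ModuleCat.ofHom (koszulD M y j) :=
      ChainComplex.of_d (fun i => ModuleCat.of R (Subsets ℓ i → M))
        (fun i => ModuleCat.ofHom (koszulD M y i)) j
    rw [hd, hd]
    exact ModuleCat.hom_ext (koszulScale_comm M h j)

/-- The transition map `φ_n^m : K_•(x^m, M) ⟶ K_•(x^n, M)` for `n ≤ m`. -/
def koszulTransition (x : Fin ℓ → R) {n m : ℕ} (h : n ≤ m) :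
    koszulComplex M (fun j => x j ^ m) ⟶ koszulComplex M (fun j => x j ^ n) :=
  koszulMap M (c := fun j => x j ^ (m - n)) (fun j => pow_sub_mul_pow (x j) h)

/-- The finite sequence `x` is `M`-weakly proregular: for each `n` there is `m ≥ n` such that
`φ_n^m` induces the zero map `H_i(x^m, M) → H_i(x^n, M)` for all `i ≥ 1`. -/
def IsWeaklyProregular (x : List R) : Prop :=
  ∀ n : ℕ, ∃ (m : ℕ) (h : n ≤ m), ∀ i : ℕ, 1 ≤ i →
    HomologicalComplex.homologyMap (koszulTransition M x.get h) i = 0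

end Koszul

/-! ### The Čech complex -/

section Cech

variable {R : Type u} [CommRing R] (M : Type v) [AddCommGroup M] [Module R M] {ℓ : ℕ}

/-- The localization of `M` at the powers of `∏ j ∈ s, x j`. -/
abbrev CechLoc (x : Fin ℓ → R) (s : Finset (Fin ℓ)) : Type (max u v) :=
  LocalizedModule (Submonoid.powers (∏ j ∈ s, x j)) M

theorem isUnit_cechLoc (x : Fin ℓ → R) {s t : Finset (Fin ℓ)} (h : s ⊆ t)
    (r : Submonoid.powers (∏ j ∈ s, x j)) :
    IsUnit (algebraMap R (Module.End R (CechLoc M x t)) r) := by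
  obtain ⟨r, n, rfl⟩ := r
  obtain ⟨c, hc⟩ := pow_dvd_pow_of_dvd (Finset.prod_dvd_prod_of_subset s t x h) n
  have hu : IsUnit (algebraMap R (Module.End R (CechLoc M x t)) ((∏ j ∈ t, x j) ^ n)) :=
    IsLocalizedModule.map_units (LocalizedModule.mkLinearMap
      (Submonoid.powers (∏ j ∈ t, x j)) M) (⟨_, n, rfl⟩ : Submonoid.powers (∏ j ∈ t, x j))
  rw [hc, map_mul] at hu
  exact ((Algebra.commute_algebraMap_left _ _).isUnit_mul_iff.1 hu).1

/-- The natural map between localizations for `s ⊆ t`. -/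
def cechRes (x : Fin ℓ → R) {s t : Finset (Fin ℓ)} (h : s ⊆ t) :
    CechLoc M x s →ₗ[R] CechLoc M x t :=
  LocalizedModule.lift _ (LocalizedModule.mkLinearMap _ M) (isUnit_cechLoc M x h)

theorem cechRes_comp (x : Fin ℓ → R) {s t w : Finset (Fin ℓ)} (h : s ⊆ t) (h' : t ⊆ w) :
    cechRes M x h' ∘ₗ cechRes M x h = cechRes M x (h.trans h') := by
  refine IsLocalizedModule.ext (Submonoid.powers (∏ j ∈ s, x j))
    (LocalizedModule.mkLinearMap (Submonoid.powers (∏ j ∈ s, x j)) M)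
    (isUnit_cechLoc M x (h.trans h')) ?_
  rw [LinearMap.comp_assoc]
  simp only [cechRes, LocalizedModule.lift_comp]

/-- The Čech differential `C^i(x; M) → C^{i+1}(x; M)`, where `C^i(x; M)` is the product, over the
`i`-element subsets `s` of `{1, …, ℓ}`, of the localizations of `M` at `∏ j ∈ s, x j`. -/
def cechD (x : Fin ℓ → R) (i : ℕ) :
    ((s : Subsets ℓ i) → CechLoc M x s.1) →ₗ[R] ((t : Subsets ℓ (i + 1)) → CechLoc M x t.1) where
  toFun f t := ∑ j, if h : j ∈ t.1 then
      sgn R j t.1 • cechRes M x (t.1.erase_subset j)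
        (f ⟨t.1.erase j, by rw [Finset.card_erase_of_mem h, t.2]; rfl⟩)
    else 0
  map_add' f g := by
    ext t
    simp only [Pi.add_apply, ← Finset.sum_add_distrib]
    refine Finset.sum_congr rfl fun j _ => ?_
    split_ifs <;> simp
  map_smul' r f := by
    ext t
    simp only [Pi.smul_apply, RingHom.id_apply, Finset.smul_sum]
    refine Finset.sum_congr rfl fun j _ => ?_
    split_ifs
    · rw [map_smul, smul_comm (sgn R j t.1) r]
    · simp

theorem cechD_apply (x : Fin ℓ → R) (i : ℕ) (f : (s : Subsets ℓ i) → CechLoc M x s.1)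
    (t : Subsets ℓ (i + 1)) :
    cechD M x i f t = ∑ j, if h : j ∈ t.1 then
      sgn R j t.1 • cechRes M x (t.1.erase_subset j)
        (f ⟨t.1.erase j, by rw [Finset.card_erase_of_mem h, t.2]; rfl⟩)
    else 0 := rfl

theorem cechRes_congr (x : Fin ℓ → R) {i : ℕ} (f : (s : Subsets ℓ i) → CechLoc M x s.1)
    {s s' t : Finset (Fin ℓ)} (e : s = s') (hs : s.card = i) (hs' : s'.card = i)
    (h : s ⊆ t) (h' : s' ⊆ t) :
    cechRes M x h (f ⟨s, hs⟩) = cechRes M x h' (f ⟨s', hs'⟩) := by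
  subst e
  rfl

theorem cechD_comp (x : Fin ℓ → R) (i : ℕ) :
    cechD M x (i + 1) ∘ₗ cechD M x i = 0 := by
  refine LinearMap.ext fun f => funext fun t => ?_
  let F : Fin ℓ → Fin ℓ → CechLoc M x t.1 := fun j k =>
    if h : j ∈ t.1 ∧ k ∈ t.1 ∧ j ≠ k then
      (sgn R j t.1 * sgn R k (t.1.erase j)) •
        cechRes M x (((t.1.erase j).erase_subset k).trans (t.1.erase_subset j))
          (f ⟨(t.1.erase j).erase k, by
            rw [Finset.card_erase_of_mem (Finset.mem_erase.2 ⟨h.2.2.symm, h.2.1⟩),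
              Finset.card_erase_of_mem h.1, t.2]; rfl⟩)
    else 0
  have hF : ∀ j k, F j k + F k j = 0 := by
    intro j k
    by_cases h : j ∈ t.1 ∧ k ∈ t.1 ∧ j ≠ k
    · have h' : k ∈ t.1 ∧ j ∈ t.1 ∧ k ≠ j := ⟨h.2.1, h.1, h.2.2.symm⟩
      simp only [F, dif_pos h, dif_pos h']
      have hs : sgn R j t.1 * sgn R k (t.1.erase j) =
          -(sgn R k t.1 * sgn R j (t.1.erase k)) := by
        have hj : j ∉ (t.1.erase j).erase k := by simp
        have hk : k ∉ (t.1.erase j).erase k := by simp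
        have e1 : insert k ((t.1.erase j).erase k) = t.1.erase j :=
          Finset.insert_erase (Finset.mem_erase.2 ⟨h.2.2.symm, h.2.1⟩)
        have e2 : insert j ((t.1.erase j).erase k) = t.1.erase k := by
          rw [Finset.erase_right_comm]
          exact Finset.insert_erase (Finset.mem_erase.2 ⟨h.2.2, h.1⟩)
        have := sgn_swap R h.2.2 hj hk
        rw [e1, e2] at this
        have a1 := sgn_erase R j (t.1.erase k)
        have a2 := sgn_erase R k (t.1.erase j)
        rw [Finset.erase_right_comm] at a1
        rw [a1, a2, sgn_erase, sgn_erase] at this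
        linear_combination this
      rw [hs, neg_smul, neg_add_eq_zero]
      rw [cechRes_congr M x f (Finset.erase_right_comm (a := j) (b := k))]
    · have h' : ¬ (k ∈ t.1 ∧ j ∈ t.1 ∧ k ≠ j) := fun h' => h ⟨h'.2.1, h'.1, h'.2.2.symm⟩
      simp only [F, dif_neg h, dif_neg h', add_zero]
  have key : (cechD M x (i + 1) (cechD M x i f)) t = ∑ p : Fin ℓ × Fin ℓ, F p.1 p.2 := by
    rw [cechD_apply, Fintype.sum_prod_type]
    refine Finset.sum_congr rfl fun j _ => ?_
    by_cases hj : j ∈ t.1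
    · rw [dif_pos hj, cechD_apply, map_sum, Finset.smul_sum]
      refine Finset.sum_congr rfl fun k _ => ?_
      by_cases hk : k ∈ t.1.erase j
      · have h1 : k ≠ j ∧ k ∈ t.1 := by simpa using hk
        rw [dif_pos hk]
        simp only [F, dif_pos (show j ∈ t.1 ∧ k ∈ t.1 ∧ j ≠ k from ⟨hj, h1.2, h1.1.symm⟩)]
        rw [map_smul, smul_smul, ← LinearMap.comp_apply, cechRes_comp]
      · rw [dif_neg hk, map_zero, smul_zero]
        symm
        refine dif_neg fun h => ?_
        exact hk (Finset.mem_erase.2 ⟨h.2.2.symm, h.2.1⟩)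
    · rw [dif_neg hj, Finset.sum_eq_zero]
      intro k _
      exact dif_neg fun h => hj h.1
  rw [LinearMap.comp_apply, key]
  refine Finset.sum_involution (fun p _ => p.swap) (fun p _ => hF p.1 p.2) ?_
    (fun _ _ => Finset.mem_univ _) (fun p _ => p.swap_swap)
  rintro ⟨j, k⟩ _ h1 h2
  obtain rfl : k = j := congrArg Prod.fst h2
  exact h1 (dif_neg fun h => h.2.2 rfl)

/-- The Čech complex `C(x; M)`. -/
def cechComplex (x : Fin ℓ → R) : CochainComplex (ModuleCat.{max u v} R) ℕ :=
  CochainComplex.of (fun i => ModuleCat.of R ((s : Subsets ℓ i) → CechLoc M x s.1))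
    (fun i => ModuleCat.ofHom (cechD M x i))
    (fun i => by rw [← ModuleCat.ofHom_comp, cechD_comp]; rfl)

/-- The `i`-th Čech cohomology module `H^i_x(M)`. -/
abbrev cechCohomology (x : List R) (i : ℕ) : ModuleCat.{max u v} R :=
  (cechComplex M x.get).homology i

end Cech

/-! ### Parameter sequences, regular sequences, Cohen–Macaulay modules -/

section CohenMacaulay

variable {R : Type u} [CommRing R] (M : Type v) [AddCommGroup M] [Module R M]

/-- The finite sequence `x` is a parameter sequence on `M`: it is `M`-weakly proregular,
`xM ≠ M`, and `H^ℓ_x(M)_p ≠ 0`, with `ℓ` the length of `x`, for all `p` in the support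
of `M/xM`. -/
structure IsParameterSequence (x : List R) : Prop where
  weaklyProregular : IsWeaklyProregular M x
  smul_top_ne : Ideal.ofList x • (⊤ : Submodule R M) ≠ ⊤
  nontrivial : ∀ p ∈ Module.support R (M ⧸ (Ideal.ofList x • (⊤ : Submodule R M))),
    Nontrivial (LocalizedModule p.asIdeal.primeCompl (cechCohomology M x x.length))

/-- Every nonempty initial segment is a parameter sequence on `M`. -/
def IsStrongParameterSequence (x : List R) : Prop :=
  ∀ i : ℕ, 1 ≤ i → i ≤ x.length → IsParameterSequence M (x.take i)

/-- `M`-regular sequences, with the convention that the empty sequence is regular on every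
module, including the zero module. -/
def IsRegularSequence (x : List R) : Prop :=
  x = [] ∨ RingTheory.Sequence.IsRegular M x

variable (R) in
/-- `M` is a Cohen–Macaulay `R`-module: every strong parameter sequence on `M` is
`M`-regular. -/
def IsCohenMacaulay : Prop :=
  ∀ x : List R, IsStrongParameterSequence M x → IsRegularSequence M x

/-- A ring is Cohen–Macaulay in the sense of Hamilton and Marley if it is Cohen–Macaulay as a
module over itself. -/
def IsCohenMacaulayRing (S : Type u) [CommRing S] : Prop :=
  IsCohenMacaulay S S

end CohenMacaulay

end HamiltonMarley

end

/-! Write `S` for the trivial extension. The kernel of `fst : S → R` has square zero, so an entry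
`y` of a sequence in `S` differs from `inl y.fst` by an element of square zero. Such a perturbation
changes neither weak proregularity nor the vanishing of localized top Čech cohomology, because the
powers of `z` and `z + ε` divide each other up to a shift of the exponent by one
(`koszulNull_of_sq_eq_zero`, `topCechVanishes_add_of_sq_eq_zero`). For sequences from `R`, the
Koszul complex over `S` is the direct sum of those over `R` and `M` (`koszulNull_inl_iff`). Hence
strong parameter sequences of `S` project to strong parameter sequences of `R`, and those of `R`
lift to `S` along `inl` as soon as weak proregularity passes from `R` to `M`.

Regularity follows the exact sequence `0 → M → S → R → 0`: a sequence whose image in `R` is weakly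
regular on `R` and on `M` is weakly regular on `S`, and for sequences from `R` the converse holds
because `R` and `M` are `R`-linear retracts of `S`. This gives the sufficient condition without
hypotheses on proregularity. For the necessary one, `R`-regular sequences must themselves be strong
parameter sequences: their Koszul complex is acyclic, which gives weak proregularity and also shows
that relations among powers of the entries are the trivial ones, so that the top Čech cohomology
survives at every prime containing the sequence.

Both homological conditions are first made elementary: `KoszulNull` treats all Koszul degrees at
once, and `TopCechVanishes` is an ideal membership. -/

noncomputable section

namespace HamiltonMarley

/-! ### Weakly regular sequences -/

section WeaklyRegular

open RingTheory.Sequence Pointwise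

variable {R : Type*} [CommRing R]

/-- Since `x` is a non-zero-divisor on `C`, the sequence stays short exact after reduction modulo
`x`, so induction on the length applies to the quotients. -/
theorem isWeaklyRegular_of_exact {A B C : Type*} [AddCommGroup A] [AddCommGroup B] [AddCommGroup C]
    [Module R A] [Module R B] [Module R C] {f : A →ₗ[R] B} {g : B →ₗ[R] C} {xs : List R}
    (hf : Function.Injective f) (hfg : Function.Exact f g) (hg : Function.Surjective g)
    (hA : IsWeaklyRegular A xs) (hC : IsWeaklyRegular C xs) : IsWeaklyRegular B xs := by
  induction xs generalizing A B C with
  | nil => exact .nil R B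
  | cons x xs ih =>
    rw [isWeaklyRegular_cons_iff] at hA hC ⊢
    refine ⟨isSMulRegular_of_range_eq_ker hf (LinearMap.exact_iff.1 hfg).symm hA.1 hC.1,
      ih (f := QuotSMulTop.map x f) (g := QuotSMulTop.map x g) ?_
        (QuotSMulTop.map_exact x hfg hg) (QuotSMulTop.map_surjective x hg) hA.2 hC.2⟩
    have h0 : Function.Exact (0 : PUnit.{1} →ₗ[R] A) f :=
      LinearMap.exact_iff.2 (by rw [LinearMap.ker_eq_bot.2 hf, LinearMap.range_zero])
    -- Padding the sequence on the left with zero turns exactness at `A`, modulo `x`, into the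
    -- required injectivity.
    have := QuotSMulTop.map_first_exact_on_four_term_exact_of_isSMulRegular_last h0 hfg hC.1
    rw [← LinearMap.ker_eq_bot, LinearMap.exact_iff.1 this, map_zero, LinearMap.range_zero]

theorem isWeaklyRegular_of_retract {A B : Type*} [AddCommGroup A] [AddCommGroup B]
    [Module R A] [Module R B] {f : A →ₗ[R] B} {g : B →ₗ[R] A} {xs : List R}
    (hgf : g ∘ₗ f = LinearMap.id) (hB : IsWeaklyRegular B xs) : IsWeaklyRegular A xs := by
  induction xs generalizing A B with
  | nil => exact .nil R A
  | cons x xs ih =>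
    rw [isWeaklyRegular_cons_iff] at hB ⊢
    refine ⟨hB.1.of_injective f (Function.LeftInverse.injective (g := g)
      fun a => LinearMap.congr_fun hgf a), ih (f := QuotSMulTop.map x f)
      (g := QuotSMulTop.map x g) ?_ hB.2⟩
    rw [← QuotSMulTop.map_comp, hgf, QuotSMulTop.map_id]

theorem isWeaklyRegular_of_subsingleton (M : Type*) [AddCommGroup M] [Module R M] [Subsingleton M]
    (xs : List R) : IsWeaklyRegular M xs := by
  induction xs generalizing M with
  | nil => exact .nil R M
  | cons x xs ih =>
    have : Subsingleton (QuotSMulTop x M) := (Submodule.mkQ_surjective _).subsingleton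
    exact .cons (Function.injective_of_subsingleton _) (ih _)

/-- Induction along `0 → M/xⁿM → M/xⁿ⁺¹M → M/xM → 0`, whose first map is multiplication by `x`. For
`n = 0` the quotient is the zero module, on which every sequence is weakly regular; exponent zero
does occur later. -/
theorem isWeaklyRegular_quotSMulTop_pow {M : Type*} [AddCommGroup M] [Module R M] {x : R}
    {xs : List R} (hx : IsSMulRegular M x) (hxs : IsWeaklyRegular (QuotSMulTop x M) xs) (n : ℕ) :
    IsWeaklyRegular (QuotSMulTop (x ^ n) M) xs := by
  induction n with
  | zero =>
    have : Subsingleton (QuotSMulTop (x ^ 0) M) := by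
      rw [QuotSMulTop, Submodule.Quotient.subsingleton_iff, pow_zero, one_smul]
    exact isWeaklyRegular_of_subsingleton _ _
  | succ n ih =>
    have hmem (k : ℕ) (a : M) :
        a ∈ (x ^ k • ⊤ : Submodule R M) ↔ ∃ b : M, x ^ k • b = a := by
      simp [Submodule.mem_smul_pointwise_iff_exists]
    have hmem1 (a : M) : a ∈ (x • ⊤ : Submodule R M) ↔ ∃ b : M, x • b = a := by
      simp [Submodule.mem_smul_pointwise_iff_exists]
    let f : QuotSMulTop (x ^ n) M →ₗ[R] QuotSMulTop (x ^ (n + 1)) M :=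
      Submodule.mapQ _ _ (LinearMap.lsmul R M x) fun a ha => by
        obtain ⟨b, rfl⟩ := (hmem n a).1 ha
        exact (hmem (n + 1) _).2 ⟨b, by simp [pow_succ, mul_smul]⟩
    let g : QuotSMulTop (x ^ (n + 1)) M →ₗ[R] QuotSMulTop x M :=
      Submodule.mapQ _ _ LinearMap.id fun a ha => by
        obtain ⟨b, rfl⟩ := (hmem (n + 1) a).1 ha
        exact (hmem1 _).2 ⟨x ^ n • b, by simp [pow_succ', mul_smul]⟩
    refine isWeaklyRegular_of_exact (f := f) (g := g) ?_ ?_ ?_ ih hxs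
    · rw [injective_iff_map_eq_zero]
      intro a
      obtain ⟨a, rfl⟩ := Submodule.mkQ_surjective _ a
      intro h
      obtain ⟨b, hb⟩ := (hmem (n + 1) _).1 ((Submodule.Quotient.mk_eq_zero _).1 h)
      refine (Submodule.Quotient.mk_eq_zero _).2 ((hmem n a).2 ⟨b, hx ?_⟩)
      simpa [pow_succ', mul_smul] using hb
    · intro a
      obtain ⟨a, rfl⟩ := Submodule.mkQ_surjective _ a
      constructor
      · intro h
        obtain ⟨b, hb⟩ := (hmem1 _).1 ((Submodule.Quotient.mk_eq_zero _).1 h)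
        exact ⟨Submodule.Quotient.mk b, congrArg _ hb⟩
      · rintro ⟨b, hb⟩
        obtain ⟨b, rfl⟩ := Submodule.mkQ_surjective _ b
        rw [← hb]
        exact (Submodule.Quotient.mk_eq_zero _).2 ((hmem1 _).2 ⟨b, rfl⟩)
    · intro a
      obtain ⟨a, rfl⟩ := Submodule.mkQ_surjective _ a
      exact ⟨Submodule.Quotient.mk a, rfl⟩

theorem isWeaklyRegular_pow {M : Type*} [AddCommGroup M] [Module R M] {ℓ : ℕ} {x : Fin ℓ → R}
    (h : IsWeaklyRegular M (List.ofFn x)) (a : Fin ℓ → ℕ) :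
    IsWeaklyRegular M (List.ofFn fun j => x j ^ a j) := by
  induction ℓ generalizing M with
  | zero => simp
  | succ ℓ ih =>
    rw [List.ofFn_succ, isWeaklyRegular_cons_iff] at h ⊢
    refine ⟨h.1.pow _, ?_⟩
    exact ih (isWeaklyRegular_quotSMulTop_pow h.1 h.2 _) _

end WeaklyRegular

/-! ### Homology of complexes of modules in terms of elements -/

section Homology

open HomologicalComplex

variable {R : Type u} [CommRing R] {ι : Type*} {c : ComplexShape ι}

theorem exists_cycles_eq (K : HomologicalComplex (ModuleCat.{v} R) c) {j k : ι}
    (hk : c.next j = k) (z : K.X j) (hz : K.d j k z = 0) : ∃ y : K.cycles j, K.iCycles j y = z := by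
  let T := ShortComplex.mk (K.iCycles j) (K.d j k) (by simp)
  have hT : T.Exact := T.exact_of_f_is_kernel (K.cyclesIsKernel j k hk)
  exact (ShortComplex.moduleCat_exact_iff T).1 hT z hz

theorem homologyπ_eq_zero_iff (K : HomologicalComplex (ModuleCat.{v} R) c) {i j : ι}
    (hi : c.prev j = i) (y : K.cycles j) :
    K.homologyπ j y = 0 ↔ ∃ w : K.X i, K.d i j w = K.iCycles j y := by
  let T := ShortComplex.mk (K.toCycles i j) (K.homologyπ j) (by simp)
  have hT : T.Exact := T.exact_of_g_is_cokernel (K.homologyIsCokernel i j hi)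
  have hmono : Function.Injective (K.iCycles j) := (ModuleCat.mono_iff_injective _).1 inferInstance
  have hd (w : K.X i) : K.iCycles j (K.toCycles i j w) = K.d i j w := by
    rw [← ConcreteCategory.comp_apply, toCycles_i]
  constructor
  · intro h
    obtain ⟨w, hw⟩ := (ShortComplex.moduleCat_exact_iff T).1 hT y h
    exact ⟨w, by rw [← hd]; exact congrArg _ hw⟩
  · rintro ⟨w, hw⟩
    rw [← hd] at hw
    rw [← hmono hw, ← ConcreteCategory.comp_apply, toCycles_comp_homologyπ]
    rfl

theorem homologyπ_surjective (K : HomologicalComplex (ModuleCat.{v} R) c) (j : ι) :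
    Function.Surjective (K.homologyπ j) :=
  (ModuleCat.epi_iff_surjective _).1 inferInstance

theorem d_iCycles (K : HomologicalComplex (ModuleCat.{v} R) c) (j k : ι) (y : K.cycles j) :
    K.d j k (K.iCycles j y) = 0 := by
  rw [← ConcreteCategory.comp_apply, iCycles_d]
  rfl

theorem homologyMap_eq_zero_iff {K L : HomologicalComplex (ModuleCat.{v} R) c} (φ : K ⟶ L)
    {i j k : ι} (hi : c.prev j = i) (hk : c.next j = k) :
    homologyMap φ j = 0 ↔
      ∀ z : K.X j, K.d j k z = 0 → ∃ w : L.X i, L.d i j w = φ.f j z := by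
  have hφ (y : K.cycles j) : homologyMap φ j (K.homologyπ j y) = 0 ↔
      ∃ w : L.X i, L.d i j w = φ.f j (K.iCycles j y) := by
    rw [← ConcreteCategory.comp_apply, homologyπ_naturality, ConcreteCategory.comp_apply,
      homologyπ_eq_zero_iff L hi, ← ConcreteCategory.comp_apply (cyclesMap φ j), cyclesMap_i]
    rfl
  constructor
  · intro h z hz
    obtain ⟨y, rfl⟩ := exists_cycles_eq K hk z hz
    exact (hφ y).1 (by rw [h]; rfl)
  · intro h
    ext a
    obtain ⟨y, rfl⟩ := homologyπ_surjective K j a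
    exact (hφ y).2 (h _ (d_iCycles K j k y))

end Homology

/-! ### The total Koszul complex -/

section TotalKoszul

variable {R : Type u} [CommRing R] (M : Type v) [AddCommGroup M] [Module R M] {ℓ : ℕ}

/-- The Koszul differential on `⨁_i K_i(x, M)`, the families of elements of `M` indexed by all
subsets of `{1, …, ℓ}`. -/
def koszulTotalD (x : Fin ℓ → R) : (Finset (Fin ℓ) → M) →ₗ[R] (Finset (Fin ℓ) → M) where
  toFun F s := ∑ j, if j ∈ s then 0 else sgn R j s • x j • F (insert j s)
  map_add' F G := by
    ext s
    simp only [Pi.add_apply, ← Finset.sum_add_distrib]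
    refine Finset.sum_congr rfl fun j _ => ?_
    split_ifs <;> simp
  map_smul' r F := by
    ext s
    simp only [Pi.smul_apply, RingHom.id_apply, Finset.smul_sum]
    refine Finset.sum_congr rfl fun j _ => ?_
    split_ifs
    · simp
    · rw [smul_comm (x j) r, smul_comm (sgn R j s) r]

theorem koszulTotalD_apply (x : Fin ℓ → R) (F : Finset (Fin ℓ) → M) (s : Finset (Fin ℓ)) :
    koszulTotalD M x F s = ∑ j, if j ∈ s then 0 else sgn R j s • x j • F (insert j s) := rfl

variable {M}

theorem koszulTotalD_apply_eq (x : Fin ℓ → R) (F : Finset (Fin ℓ) → M) {i : ℕ} (s : Subsets ℓ i) :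
    koszulTotalD M x F s.1 = koszulD M x i (fun t => F t.1) s := by
  rw [koszulTotalD_apply, koszulD_apply]
  refine Finset.sum_congr rfl fun j _ => ?_
  split_ifs <;> rfl

theorem koszulTotalD_comp (x : Fin ℓ → R) (F : Finset (Fin ℓ) → M) :
    koszulTotalD M x (koszulTotalD M x F) = 0 := by
  ext s
  rw [koszulTotalD_apply_eq x _ (⟨s, rfl⟩ : Subsets ℓ s.card)]
  simp only [koszulTotalD_apply_eq]
  exact congrFun (LinearMap.congr_fun (koszulD_comp M x s.card) _) ⟨s, rfl⟩

/-- Multiplication of the `s`-component by `∏ j ∈ s, c j`. -/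
def koszulTotalScale (c : Fin ℓ → R) (F : Finset (Fin ℓ) → M) : Finset (Fin ℓ) → M :=
  fun s => (∏ j ∈ s, c j) • F s

theorem koszulTotalScale_empty (c : Fin ℓ → R) {F : Finset (Fin ℓ) → M} :
    koszulTotalScale c F ∅ = F ∅ := by
  simp [koszulTotalScale]

theorem koszulTotalScale_mul (c c' : Fin ℓ → R) (F : Finset (Fin ℓ) → M) :
    koszulTotalScale c (koszulTotalScale c' F) = koszulTotalScale (fun j => c j * c' j) F := by
  ext s
  simp [koszulTotalScale, Finset.prod_mul_distrib, mul_smul]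

theorem koszulTotalScale_zero (c : Fin ℓ → R) :
    koszulTotalScale c (0 : Finset (Fin ℓ) → M) = 0 := by
  ext s
  simp [koszulTotalScale]

theorem koszulTotalD_scale {a b c : Fin ℓ → R} (h : ∀ j, c j * b j = a j)
    (F : Finset (Fin ℓ) → M) :
    koszulTotalD M b (koszulTotalScale c F) = koszulTotalScale c (koszulTotalD M a F) := by
  ext s
  simp only [koszulTotalScale, koszulTotalD_apply, Finset.smul_sum]
  refine Finset.sum_congr rfl fun j _ => ?_
  split_ifs with hj
  · simp
  · rw [Finset.prod_insert hj, ← h j]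
    simp only [smul_smul]
    congr 1
    ring

variable (M) in
/-- Multiplication by `c` sends cycles of positive degree of `K_•(a, M)` to boundaries
of `K_•(b, M)`. -/
def KoszulNull (a b c : Fin ℓ → R) : Prop :=
  ∀ F : Finset (Fin ℓ) → M, koszulTotalD M a F = 0 → F ∅ = 0 →
    ∃ G, koszulTotalD M b G = koszulTotalScale c F

/-- A map that is null on homology stays so after composition with the chain maps `K(a') → K(a)` and
`K(b) → K(b')` given by `d` and `e`. -/
theorem KoszulNull.comp {a b c a' b' d e : Fin ℓ → R} (h : KoszulNull M a b c)
    (hd : ∀ j, d j * a j = a' j) (he : ∀ j, e j * b' j = b j) :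
    KoszulNull M a' b' (fun j => e j * c j * d j) := by
  intro F hF hF0
  obtain ⟨G, hG⟩ := h (koszulTotalScale d F)
    (by rw [koszulTotalD_scale hd, hF, koszulTotalScale_zero]) (by rw [koszulTotalScale_empty, hF0])
  refine ⟨koszulTotalScale e G, ?_⟩
  rw [koszulTotalD_scale he, hG, koszulTotalScale_mul, koszulTotalScale_mul]

theorem koszulComplex_d (x : Fin ℓ → R) (i : ℕ) :
    (koszulComplex M x).d (i + 1) i = ModuleCat.ofHom (koszulD M x i) :=
  ChainComplex.of_d (fun i => ModuleCat.of R (Subsets ℓ i → M))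
    (fun i => ModuleCat.ofHom (koszulD M x i)) i

theorem homologyMap_koszulMap_eq_zero_iff {a b c : Fin ℓ → R} (h : ∀ j, c j * b j = a j) (i : ℕ) :
    HomologicalComplex.homologyMap (koszulMap M h) (i + 1) = 0 ↔
      ∀ f : Subsets ℓ (i + 1) → M, koszulD M a i f = 0 →
        ∃ g : Subsets ℓ (i + 2) → M, koszulD M b (i + 1) g = koszulScale M c (i + 1) f := by
  rw [homologyMap_eq_zero_iff (koszulMap M h) (i := i + 2) (j := i + 1) (k := i) (by simp) (by simp),
    koszulComplex_d, koszulComplex_d]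
  rfl

theorem homologyMap_koszulMap_eq_zero_iff_koszulNull {a b c : Fin ℓ → R}
    (h : ∀ j, c j * b j = a j) :
    (∀ i, 1 ≤ i → HomologicalComplex.homologyMap (koszulMap M h) i = 0) ↔
      KoszulNull M a b c := by
  constructor
  · intro H F hF hF0
    have key (i : ℕ) : ∃ g : Subsets ℓ (i + 1) → M,
        koszulD M b i g = koszulScale M c i (fun s => F s.1) := by
      cases i with
      | zero =>
        refine ⟨0, ?_⟩
        ext ⟨s, hs⟩
        obtain rfl := Finset.card_eq_zero.1 hs
        simp [koszulScale, hF0]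
      | succ i =>
        refine (homologyMap_koszulMap_eq_zero_iff h i).1 (H _ (by omega)) _ ?_
        ext s
        rw [← koszulTotalD_apply_eq, hF]
        rfl
    choose g hg using key
    have hcongr {k k' : ℕ} {t : Finset (Fin ℓ)} (h : t.card = k + 1) (h' : t.card = k' + 1) :
        g k ⟨t, h⟩ = g k' ⟨t, h'⟩ := by
      obtain rfl : k = k' := by omega
      rfl
    -- The degree-`i` boundary is hit from degree `i + 1`, hence the index `s.card - 1`. The value
    -- at `∅` is irrelevant, since the differential only reads sets of the form `insert j s`.
    refine ⟨fun s => if hs : s = ∅ then 0 else g (s.card - 1) ⟨s, by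
      have := Finset.card_pos.2 (Finset.nonempty_iff_ne_empty.2 hs); omega⟩, ?_⟩
    ext s
    refine Eq.trans ?_ (congrFun (hg s.card) ⟨s, rfl⟩)
    rw [koszulTotalD_apply, koszulD_apply]
    refine Finset.sum_congr rfl fun j _ => ?_
    split_ifs with hj h0
    · rfl
    · exact absurd h0 (Finset.insert_ne_empty _ _)
    · exact congrArg _ (congrArg _ (hcongr _ _))
  · rintro H (_ | i) hi
    · omega
    rw [homologyMap_koszulMap_eq_zero_iff]
    intro f hf
    -- The chain `f` is extended by zero to all degrees; only the component of `G` in degree `i + 2`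
    -- is kept.
    obtain ⟨G, hG⟩ := H (fun s => if hs : s.card = i + 1 then f ⟨s, hs⟩ else 0) (by
      ext s
      by_cases hs : s.card = i
      · rw [koszulTotalD_apply_eq a (s := (⟨s, hs⟩ : Subsets ℓ i))]
        refine Eq.trans ?_ (congrFun hf ⟨s, hs⟩)
        exact congrArg (fun f => koszulD M a i f ⟨s, hs⟩) (funext fun t => dif_pos t.2)
      · rw [koszulTotalD_apply]
        refine Finset.sum_eq_zero fun j _ => ?_
        split_ifs with hj h
        · rfl
        · rw [Finset.card_insert_of_notMem hj] at h; omega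
        · simp) (by simp)
    refine ⟨fun s => G s.1, ?_⟩
    ext s
    rw [← koszulTotalD_apply_eq, hG]
    simp [koszulTotalScale, koszulScale, s.2]

theorem isWeaklyProregular_iff (x : List R) :
    IsWeaklyProregular M x ↔ ∀ n : ℕ, ∃ m, n ≤ m ∧
      KoszulNull M (fun j => x.get j ^ m) (fun j => x.get j ^ n) (fun j => x.get j ^ (m - n)) := by
  simp only [IsWeaklyProregular, koszulTransition, homologyMap_koszulMap_eq_zero_iff_koszulNull,
    exists_prop]

end TotalKoszul

/-! ### Acyclicity of the Koszul complex of a regular sequence -/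

section Acyclic

open RingTheory.Sequence Pointwise

variable {R : Type u} [CommRing R] {M : Type v} [AddCommGroup M] [Module R M] {ℓ : ℕ}

/-- The shift of a subset of `{1, …, ℓ}` to `{2, …, ℓ + 1}`. -/
abbrev shift (s : Finset (Fin ℓ)) : Finset (Fin (ℓ + 1)) := s.map (Fin.succEmb ℓ)

/-- The subset of those `j` for which `j + 1` lies in `t`. -/
def unshift (t : Finset (Fin (ℓ + 1))) : Finset (Fin ℓ) := {j | j.succ ∈ t}

theorem unshift_shift (s : Finset (Fin ℓ)) : unshift (shift s) = s := by
  ext j; simp [unshift]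

theorem unshift_insert_zero (t : Finset (Fin (ℓ + 1))) : unshift (insert 0 t) = unshift t := by
  ext j; simp [unshift, Fin.succ_ne_zero]

theorem zero_notMem_shift (s : Finset (Fin ℓ)) : 0 ∉ shift s := by
  simp [Fin.succ_ne_zero]

theorem eq_shift_or_eq_insert_shift (t : Finset (Fin (ℓ + 1))) :
    ∃ s : Finset (Fin ℓ), t = shift s ∨ t = insert 0 (shift s) := by
  refine ⟨unshift t, ?_⟩
  by_cases h : 0 ∈ t
  · right
    ext j
    cases j using Fin.cases <;> simp [unshift, h, Fin.succ_ne_zero]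
  · left
    ext j
    cases j using Fin.cases <;> simp [unshift, h, Fin.succ_ne_zero]

theorem sgn_succ_shift (j : Fin ℓ) (s : Finset (Fin ℓ)) : sgn R j.succ (shift s) = sgn R j s := by
  unfold sgn
  rw [Finset.filter_map, Finset.card_map]
  congr 3
  ext k
  simp

theorem insert_succ_shift (j : Fin ℓ) (s : Finset (Fin ℓ)) :
    insert j.succ (shift s) = shift (insert j s) := by
  simp [shift, Finset.map_insert]

theorem koszulTotalD_shift (x : Fin (ℓ + 1) → R) (F : Finset (Fin (ℓ + 1)) → M)
    (s : Finset (Fin ℓ)) :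
    koszulTotalD M x F (shift s) = x 0 • F (insert 0 (shift s)) +
      koszulTotalD M (fun j => x j.succ) (fun t => F (shift t)) s := by
  rw [koszulTotalD_apply, Fin.sum_univ_succ, if_neg (zero_notMem_shift s), koszulTotalD_apply]
  congr 1
  · simp [sgn]
  · refine Finset.sum_congr rfl fun j _ => ?_
    simp only [sgn_succ_shift, insert_succ_shift]
    simp

theorem koszulTotalD_insert_shift (x : Fin (ℓ + 1) → R) (F : Finset (Fin (ℓ + 1)) → M)
    (s : Finset (Fin ℓ)) :
    koszulTotalD M x F (insert 0 (shift s)) =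
      -koszulTotalD M (fun j => x j.succ) (fun t => F (insert 0 (shift t))) s := by
  rw [koszulTotalD_apply, Fin.sum_univ_succ, if_pos (Finset.mem_insert_self _ _), zero_add,
    koszulTotalD_apply, ← Finset.sum_neg_distrib]
  refine Finset.sum_congr rfl fun j _ => ?_
  rw [sgn_insert R (zero_notMem_shift s), if_pos (Fin.succ_pos j), sgn_succ_shift,
    Finset.insert_comm, insert_succ_shift]
  by_cases hj : j ∈ s <;> simp [hj, Fin.succ_ne_zero]

theorem koszulTotalD_map {N : Type*} [AddCommGroup N] [Module R N] (f : M →ₗ[R] N)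
    (x : Fin ℓ → R) (F : Finset (Fin ℓ) → M) (s : Finset (Fin ℓ)) :
    koszulTotalD N x (fun t => f (F t)) s = f (koszulTotalD M x F s) := by
  rw [koszulTotalD_apply, koszulTotalD_apply, map_sum]
  refine Finset.sum_congr rfl fun j _ => ?_
  split_ifs <;> simp

/-- Split a cycle into `F₀` (sets without `0`) and `F₁` (sets with `0`), and let `d` be the
differential for the remaining entries. Then `d F₀ = -x₀ F₁`, so `F₀` is a cycle modulo `x₀`. By
induction `F₀ = d c + x₀ e`, and the pair `(c, e)` bounds `F`. -/
theorem exists_koszulTotalD_eq {x : Fin ℓ → R} (hx : IsWeaklyRegular M (List.ofFn x))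
    {F : Finset (Fin ℓ) → M} (hF : koszulTotalD M x F = 0) (hF0 : F ∅ = 0) :
    ∃ G, koszulTotalD M x G = F := by
  induction ℓ generalizing M with
  | zero =>
    refine ⟨0, ?_⟩
    ext s
    rw [Finset.eq_empty_of_isEmpty s, hF0, map_zero]
    rfl
  | succ ℓ ih =>
    rw [List.ofFn_succ, isWeaklyRegular_cons_iff] at hx
    set y : Fin ℓ → R := fun j => x j.succ with hy
    have hmem (a : M) : a ∈ (x 0 • ⊤ : Submodule R M) ↔ ∃ b : M, x 0 • b = a := by
      simp [Submodule.mem_smul_pointwise_iff_exists]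
    let π := Submodule.mkQ (x 0 • ⊤ : Submodule R M)
    have hFs (s : Finset (Fin ℓ)) :
        koszulTotalD M y (fun t => F (shift t)) s = -(x 0 • F (insert 0 (shift s))) := by
      rw [eq_neg_iff_add_eq_zero, add_comm, hy, ← koszulTotalD_shift, hF]
      rfl
    obtain ⟨c', hc'⟩ := ih (M := QuotSMulTop (x 0) M) hx.2 (F := fun s => π (F (shift s)))
      (by
        ext s
        rw [koszulTotalD_map, hFs]
        exact (Submodule.Quotient.mk_eq_zero _).2 (neg_mem ((hmem _).2 ⟨_, rfl⟩)))
      (by simp [shift, hF0])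
    choose c hc using fun s => Submodule.mkQ_surjective _ (c' s)
    have he (s : Finset (Fin ℓ)) :
        ∃ e : M, x 0 • e = F (shift s) - koszulTotalD M y c s := by
      rw [← hmem, ← Submodule.Quotient.eq]
      change π _ = π _
      rw [← koszulTotalD_map]
      have : (fun t => π (c t)) = c' := funext hc
      rw [this, hc']
    choose e he using he
    let G : Finset (Fin (ℓ + 1)) → M := fun t => if 0 ∈ t then e (unshift t) else c (unshift t)
    have hG0 (s : Finset (Fin ℓ)) : G (shift s) = c s := by
      simp only [G]
      rw [if_neg (zero_notMem_shift s), unshift_shift]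
    have hG1 (s : Finset (Fin ℓ)) : G (insert 0 (shift s)) = e s := by
      simp only [G]
      rw [if_pos (Finset.mem_insert_self _ _), unshift_insert_zero, unshift_shift]
    refine ⟨G, funext fun t => ?_⟩
    obtain ⟨s, rfl | rfl⟩ := eq_shift_or_eq_insert_shift t
    · rw [koszulTotalD_shift]
      simp only [hG0, hG1]
      rw [he, sub_add_cancel]
    · rw [koszulTotalD_insert_shift]
      simp only [hG1]
      -- On the component containing `0` the claim is `-d e = F₁`. It is checked after
      -- multiplication by the non-zero-divisor `x 0`, using `d (x₀ e) = d F₀ - d d c = -x₀ F₁`.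
      refine hx.1 ?_
      have h1 : x 0 • e = (fun t => F (shift t)) - koszulTotalD M y c := funext he
      have h2 := congrFun (map_smul (koszulTotalD M y) (x 0) e) s
      rw [h1, map_sub, koszulTotalD_comp, sub_zero, hFs] at h2
      change x 0 • (-koszulTotalD M y e s) = _
      rw [smul_neg, ← Pi.smul_apply, ← h2, neg_neg]

theorem isWeaklyProregular_of_isWeaklyRegular {x : List R} (hx : IsWeaklyRegular M x) :
    IsWeaklyProregular M x := by
  rw [isWeaklyProregular_iff]
  refine fun n => ⟨n, le_rfl, fun F hF hF0 => ?_⟩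
  obtain ⟨G, hG⟩ := exists_koszulTotalD_eq (isWeaklyRegular_pow
    (x := x.get) (by rwa [List.ofFn_get]) fun _ => n) hF hF0
  exact ⟨G, hG.trans (by ext s; simp [koszulTotalScale])⟩

/-- The relations on a weakly regular sequence are generated by the trivial ones. -/
theorem mem_span_of_sum_smul_eq_zero {x : Fin ℓ → R} (hx : IsWeaklyRegular R (List.ofFn x))
    {w : Fin ℓ → R} (hw : ∑ j, w j * x j = 0) (i : Fin ℓ) :
    w i ∈ Ideal.span (x '' {j | j ≠ i}) := by
  -- The relation `w` is a Koszul 1-cycle. Writing it as a boundary expresses `w i` through the `x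
  -- j` with `j ≠ i`.
  let F : Finset (Fin ℓ) → R := fun s => ∑ j, if s = {j} then w j else 0
  have hF1 (j : Fin ℓ) : F {j} = w j := by simp [F]
  have hF2 (s : Finset (Fin ℓ)) (hs : s.card ≠ 1) : F s = 0 :=
    Finset.sum_eq_zero fun j _ => if_neg fun h => hs (by rw [h, Finset.card_singleton])
  obtain ⟨G, hG⟩ := exists_koszulTotalD_eq hx (F := F) (by
    ext s
    rcases Finset.eq_empty_or_nonempty s with rfl | hs
    · rw [koszulTotalD_apply]
      refine Eq.trans (Finset.sum_congr rfl fun j _ => ?_) hw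
      simp [hF1, sgn, mul_comm]
    · rw [koszulTotalD_apply]
      refine Finset.sum_eq_zero fun j _ => ?_
      split_ifs with hj
      · rfl
      · rw [hF2, smul_zero, smul_zero]
        have := hs.card_pos
        rw [Finset.card_insert_of_notMem hj]
        omega) (hF2 _ (by simp))
  rw [← hF1, ← hG, koszulTotalD_apply]
  refine sum_mem fun j _ => ?_
  split_ifs with hj
  · exact zero_mem _
  · refine Submodule.smul_mem _ _ ?_
    rw [smul_eq_mul, mul_comm]
    exact Ideal.mul_mem_left _ _ (Ideal.subset_span ⟨j, by simpa using hj, rfl⟩)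

end Acyclic

/-! ### Top Čech cohomology -/

section TopCech

variable {A : Type u} [CommRing A] {ℓ : ℕ}

/-- An elementary form of the vanishing of `H^ℓ_x(A)_p`: for all `n` there are `s ∉ p`
and `k` with `s (x_1 ⋯ x_ℓ) ^ k ∈ (x_1 ^ (n + k), …, x_ℓ ^ (n + k))`. -/
def TopCechVanishes (x : Fin ℓ → A) (p : Ideal A) : Prop :=
  ∀ n : ℕ, ∃ s ∉ p, ∃ k : ℕ,
    s * (∏ j, x j) ^ k ∈ Ideal.span (Set.range fun j => x j ^ (n + k))

theorem subsingleton_localizedModule_homology_iff {ι : Type*} {c : ComplexShape ι}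
    (K : HomologicalComplex (ModuleCat.{v} A) c) {i j k : ι} (hi : c.prev j = i) (hk : c.next j = k)
    [Subsingleton (K.X k)] (p : Ideal A) [p.IsPrime] :
    Subsingleton (LocalizedModule p.primeCompl (K.homology j)) ↔
      ∀ z : K.X j, ∃ s ∉ p, ∃ w : K.X i, K.d i j w = s • z := by
  rw [LocalizedModule.subsingleton_iff]
  constructor
  · intro h z
    obtain ⟨y, rfl⟩ := exists_cycles_eq K hk z (Subsingleton.elim _ _)
    obtain ⟨s, hs, h⟩ := h (K.homologyπ j y)
    rw [← map_smul, homologyπ_eq_zero_iff K hi, map_smul] at h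
    exact ⟨s, hs, h⟩
  · intro h a
    obtain ⟨y, rfl⟩ := homologyπ_surjective K j a
    obtain ⟨s, hs, h⟩ := h (K.iCycles j y)
    refine ⟨s, hs, ?_⟩
    rwa [← map_smul, homologyπ_eq_zero_iff K hi, map_smul]

theorem cechComplex_d (x : Fin ℓ → A) (i : ℕ) :
    (cechComplex A x).d i (i + 1) = ModuleCat.ofHom (cechD A x i) :=
  CochainComplex.of_d (fun i => ModuleCat.of A ((s : Subsets ℓ i) → CechLoc A x s.1))
    (fun i => ModuleCat.ofHom (cechD A x i)) i

theorem subsingleton_localizedModule_cech_iff (x : Fin (ℓ + 1) → A) (p : Ideal A) [p.IsPrime] :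
    Subsingleton (LocalizedModule p.primeCompl ((cechComplex A x).homology (ℓ + 1))) ↔
      ∀ c : (t : Subsets (ℓ + 1) (ℓ + 1)) → CechLoc A x t.1, ∃ s ∉ p, ∃ b, cechD A x ℓ b = s • c := by
  have : IsEmpty (Subsets (ℓ + 1) (ℓ + 2)) :=
    ⟨fun t => by have := (Finset.card_le_univ t.1).trans_eq (Fintype.card_fin _)
                 have := t.2; omega⟩
  have : Subsingleton ((cechComplex A x).X (ℓ + 2)) :=
    inferInstanceAs (Subsingleton ((s : Subsets (ℓ + 1) (ℓ + 2)) → CechLoc A x s.1))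
  rw [subsingleton_localizedModule_homology_iff (cechComplex A x) (i := ℓ) (j := ℓ + 1) (k := ℓ + 2)
    (by simp) (by simp), cechComplex_d]
  rfl

/-- The localization map `A → A_{∏ j ∈ t, x j}`. -/
abbrev toCechLoc (x : Fin ℓ → A) (t : Finset (Fin ℓ)) : A →ₗ[A] CechLoc A x t :=
  LocalizedModule.mkLinearMap _ A

theorem cechRes_toCechLoc (x : Fin ℓ → A) {s t : Finset (Fin ℓ)} (h : s ⊆ t) (a : A) :
    cechRes A x h (toCechLoc x s a) = toCechLoc x t a :=
  LinearMap.congr_fun (LocalizedModule.lift_comp _ _ (isUnit_cechLoc A x h)) a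

theorem bijective_smul_cechLoc (x : Fin ℓ → A) (t : Finset (Fin ℓ)) (n : ℕ) :
    Function.Bijective fun v : CechLoc A x t => (∏ j ∈ t, x j) ^ n • v :=
  (Module.End.isUnit_iff _).1 (isUnit_cechLoc A x subset_rfl
    (⟨_, n, rfl⟩ : Submonoid.powers (∏ j ∈ t, x j)))

theorem exists_smul_cechLoc_eq (x : Fin ℓ → A) {t : Finset (Fin ℓ)} (n : ℕ) (w : CechLoc A x t) :
    ∃ v : CechLoc A x t, (∏ j ∈ t, x j) ^ n • v = w :=
  (bijective_smul_cechLoc x t n).2 w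

theorem eq_of_smul_cechLoc_eq (x : Fin ℓ → A) {t : Finset (Fin ℓ)} (n : ℕ) {v w : CechLoc A x t}
    (h : (∏ j ∈ t, x j) ^ n • v = (∏ j ∈ t, x j) ^ n • w) : v = w :=
  (bijective_smul_cechLoc x t n).1 h

theorem exists_smul_eq_toCechLoc (x : Fin ℓ → A) {t : Finset (Fin ℓ)} (v : CechLoc A x t) :
    ∃ (n : ℕ) (a : A), (∏ j ∈ t, x j) ^ n • v = toCechLoc x t a := by
  obtain ⟨⟨a, ⟨_, n, rfl⟩⟩, h⟩ := IsLocalizedModule.surj (Submonoid.powers (∏ j ∈ t, x j))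
    (toCechLoc x t) v
  exact ⟨n, a, h⟩

theorem toCechLoc_eq_zero_iff (x : Fin ℓ → A) (t : Finset (Fin ℓ)) (a : A) :
    toCechLoc x t a = 0 ↔ ∃ n : ℕ, (∏ j ∈ t, x j) ^ n * a = 0 := by
  rw [IsLocalizedModule.eq_zero_iff (Submonoid.powers (∏ j ∈ t, x j))]
  constructor
  · rintro ⟨⟨_, n, rfl⟩, h⟩
    exact ⟨n, h⟩
  · rintro ⟨n, h⟩
    exact ⟨⟨_, n, rfl⟩, h⟩

theorem smul_cechRes_erase (x : Fin ℓ → A) {t : Finset (Fin ℓ)} {j : Fin ℓ} (hj : j ∈ t) {n : ℕ}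
    {a : A} {v : CechLoc A x (t.erase j)}
    (hv : (∏ i ∈ t.erase j, x i) ^ n • v = toCechLoc x (t.erase j) a) :
    (∏ i ∈ t, x i) ^ n • cechRes A x (t.erase_subset j) v = toCechLoc x t (x j ^ n * a) := by
  have h : (∏ i ∈ t, x i) ^ n = x j ^ n * (∏ i ∈ t.erase j, x i) ^ n := by
    rw [← Finset.mul_prod_erase t x hj, mul_pow]
  rw [h, mul_smul, ← map_smul, hv, cechRes_toCechLoc, ← smul_eq_mul, map_smul]

/-- The whole set `{1, …, ℓ}`. -/
abbrev topSubset (ℓ : ℕ) : Subsets ℓ ℓ := ⟨Finset.univ, Finset.card_fin ℓ⟩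

/-- The complement of a point of `{1, …, ℓ + 1}`. -/
abbrev coface (j : Fin (ℓ + 1)) : Subsets (ℓ + 1) ℓ :=
  ⟨Finset.univ.erase j, by rw [Finset.card_erase_of_mem (Finset.mem_univ j), Finset.card_fin]; rfl⟩

/-- Clears denominators: with `b j = a j / (∏_{i ≠ j} x i)ⁿ`, bringing the terms over the common
denominator `(∏ x i)ⁿ` costs a factor `x jⁿ` each. -/
theorem cechD_top (x : Fin (ℓ + 1) → A) (b : (s : Subsets (ℓ + 1) ℓ) → CechLoc A x s.1) (n : ℕ)
    (a : Fin (ℓ + 1) → A) (hb : ∀ j, (∏ i ∈ Finset.univ.erase j, x i) ^ n •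
      b (coface j) = toCechLoc x (Finset.univ.erase j) (a j)) :
    (∏ i, x i) ^ n • cechD A x ℓ b (topSubset _) =
      toCechLoc x Finset.univ (∑ j, sgn A j Finset.univ * (x j ^ n * a j)) := by
  rw [cechD_apply, Finset.smul_sum, map_sum]
  refine Finset.sum_congr rfl fun j _ => ?_
  rw [dif_pos (Finset.mem_univ j), smul_comm, smul_cechRes_erase x (Finset.mem_univ j) (hb j),
    ← map_smul, smul_eq_mul]

theorem sgn_mul_self (j : Fin ℓ) (s : Finset (Fin ℓ)) : sgn A j s * sgn A j s = 1 := by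
  rw [sgn, ← mul_pow]
  simp

theorem subsingleton_localizedModule_cech_iff_topCechVanishes (x : Fin (ℓ + 1) → A) (p : Ideal A)
    [p.IsPrime] :
    Subsingleton (LocalizedModule p.primeCompl ((cechComplex A x).homology (ℓ + 1))) ↔
      TopCechVanishes x p := by
  rw [subsingleton_localizedModule_cech_iff]
  constructor
  -- Test on the class of `1 / (∏ x)ⁿ`: some `s ∉ p` makes it the boundary of a cochain `b`. If `N`
  -- bounds the exponents in the denominators of `b` and a further power `t` clears the equality in
  -- the localization, then `k = N + t` works; the factor `(∏ x)ᵗ` raises `x jⁿ⁺ᴺ` to the required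
  -- power.
  · intro h n
    choose c hc using fun t : Subsets (ℓ + 1) (ℓ + 1) =>
      exists_smul_cechLoc_eq x n (toCechLoc x t.1 1)
    obtain ⟨s, hs, b, hb⟩ := h c
    choose m a ha using fun j : Fin (ℓ + 1) =>
      exists_smul_eq_toCechLoc x (b (coface j))
    have hcu : (∏ j, x j) ^ n • c (topSubset _) = toCechLoc x Finset.univ 1 :=
      hc (topSubset _)
    have hm (j : Fin (ℓ + 1)) : m j ≤ ∑ j, m j :=
      Finset.single_le_sum (f := m) (fun _ _ => Nat.zero_le _) (Finset.mem_univ j)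
    set N := ∑ j, m j
    have key := cechD_top x b (n + N)
      (fun j => (∏ i ∈ Finset.univ.erase j, x i) ^ (n + (N - m j)) * a j) (fun j => by
        rw [← smul_eq_mul, map_smul, ← ha, smul_smul, ← pow_add]
        congr 2
        have := hm j
        omega)
    rw [hb, Pi.smul_apply, smul_comm, pow_add, mul_comm, mul_smul, hcu, ← map_smul, ← map_smul,
      ← sub_eq_zero, ← map_sub, toCechLoc_eq_zero_iff] at key
    obtain ⟨t, ht⟩ := key
    refine ⟨s, hs, N + t, ?_⟩
    rw [mul_sub, sub_eq_zero, Finset.mul_sum] at ht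
    have : s * (∏ j, x j) ^ (N + t) =
        (∏ j, x j) ^ t * s • (∏ j, x j) ^ N • 1 := by
      simp only [smul_eq_mul]; ring
    rw [this, ht]
    refine sum_mem fun j _ => ?_
    rw [← Finset.mul_prod_erase _ x (Finset.mem_univ j), mul_pow]
    have h2 : x j ^ (n + (N + t)) ∈ Ideal.span (Set.range fun j => x j ^ (n + (N + t))) :=
      Ideal.subset_span ⟨j, rfl⟩
    refine Ideal.mem_of_dvd _ ?_ h2
    exact ⟨(∏ i ∈ Finset.univ.erase j, x i) ^ t * (sgn A j Finset.univ *
      ((∏ i ∈ Finset.univ.erase j, x i) ^ (n + (N - m j)) * a j)), by ring⟩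
  -- For `c = a / (∏ x)ⁿ` and `s (∏ x)ᵏ = ∑ β j x jⁿ⁺ᵏ`, the cochain `± a β j / (∏_{i ≠ j} x i)ⁿ⁺ᵏ`
  -- has boundary `s c`. Cochains are indexed by subsets, so `ν` recovers the missing index `j`.
  · intro h c
    obtain ⟨n, a, ha⟩ : ∃ (n : ℕ) (a : A), (∏ j, x j) ^ n • c (topSubset _) =
      toCechLoc x Finset.univ a := exists_smul_eq_toCechLoc x (c (topSubset _))
    obtain ⟨s, hs, k, hk⟩ := h n
    obtain ⟨β, hβ⟩ := (Ideal.mem_span_range_iff_exists_fun).1 hk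
    choose b hb using fun (t : Subsets (ℓ + 1) ℓ) (a : A) =>
      exists_smul_cechLoc_eq x (n + k) (toCechLoc x t.1 a)
    have hne (t : Subsets (ℓ + 1) ℓ) : ∃ j, j ∉ t.1 := by
      by_contra! H
      have h1 := t.2
      rw [Finset.eq_univ_iff_forall.2 H] at h1
      simp at h1
    choose ν hν using hne
    have hνe (j : Fin (ℓ + 1)) : ν (coface j) = j := by
      have := hν (coface j)
      simpa using this
    refine ⟨s, hs, fun t => b t (sgn A (ν t) Finset.univ * (a * β (ν t))), ?_⟩
    ext t
    obtain rfl : t = (topSubset _) :=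
      Subtype.ext ((Finset.card_eq_iff_eq_univ _).1 (by simp [t.2]))
    refine eq_of_smul_cechLoc_eq x (n + k) ?_
    refine (cechD_top x _ (n + k) (fun j => sgn A j Finset.univ * (a * β j))
      (fun j => (hb (coface j) _).trans (by rw [hνe]))).trans ?_
    have h1 : ∑ j, sgn A j Finset.univ * (x j ^ (n + k) * (sgn A j Finset.univ * (a * β j))) =
        (s * (∏ j, x j) ^ k) * a := by
      rw [← hβ, Finset.sum_mul]
      refine Finset.sum_congr rfl fun j _ => ?_
      linear_combination (x j ^ (n + k) * a * β j) * sgn_mul_self (A := A) j Finset.univ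
    change _ = (∏ j, x j) ^ (n + k) • s • c (topSubset (ℓ + 1))
    rw [h1, smul_comm, add_comm n, pow_add, mul_smul, ha, smul_smul, ← map_smul,
      smul_eq_mul]

theorem nontrivial_localizedModule_cech_iff {x : List A} (hx : x ≠ []) (p : Ideal A) [p.IsPrime] :
    Nontrivial (LocalizedModule p.primeCompl (cechCohomology A x x.length)) ↔
      ¬ TopCechVanishes x.get p := by
  rw [← not_subsingleton_iff_nontrivial, not_iff_not]
  cases x with
  | nil => exact absurd rfl hx
  | cons a x => exact subsingleton_localizedModule_cech_iff_topCechVanishes (a :: x).get p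

theorem ofList_eq_span_range (x : List A) : Ideal.ofList x = Ideal.span (Set.range x.get) := by
  rw [Ideal.ofList, Set.range_list_get]

theorem mem_support_quotient_ofList_iff (x : List A) (p : PrimeSpectrum A) :
    p ∈ Module.support A (A ⧸ (Ideal.ofList x • (⊤ : Submodule A A))) ↔
      Ideal.ofList x ≤ p.asIdeal := by
  rw [smul_eq_mul, Ideal.mul_top, Module.support_eq_zeroLocus, Ideal.annihilator_quotient,
    PrimeSpectrum.mem_zeroLocus, SetLike.coe_subset_coe]

theorem isParameterSequence_iff {x : List A} (hx : x ≠ []) :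
    IsParameterSequence A x ↔ IsWeaklyProregular A x ∧ Ideal.ofList x ≠ ⊤ ∧
      ∀ p : Ideal A, p.IsPrime → Ideal.ofList x ≤ p → ¬ TopCechVanishes x.get p := by
  have h : Ideal.ofList x • (⊤ : Submodule A A) = Ideal.ofList x := Ideal.mul_top _
  constructor
  · rintro ⟨h1, h2, h3⟩
    refine ⟨h1, by rwa [h] at h2, fun p hp hxp => ?_⟩
    rw [← nontrivial_localizedModule_cech_iff hx]
    exact h3 ⟨p, hp⟩ ((mem_support_quotient_ofList_iff x _).2 hxp)
  · rintro ⟨h1, h2, h3⟩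
    refine ⟨h1, by rwa [h], fun p hp => ?_⟩
    rw [nontrivial_localizedModule_cech_iff hx]
    exact h3 _ p.2 ((mem_support_quotient_ofList_iff x _).1 hp)

end TopCech

/-! ### Regular sequences are parameter sequences -/

section RegularParameter

open RingTheory.Sequence

variable {A : Type u} [CommRing A] {ℓ : ℕ}

/-- Remove one factor `x iᵏ` at a time. Moving it to the term `w i x iᵏ⁺¹` gives a relation on
powers of `x` with coefficient `w i x i - s ∏_T x jᵏ` at `x iᵏ`. That coefficient lies in the ideal
of the other powers, and `x i` itself is a generator for the smaller set `T`. -/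
theorem mem_span_of_mul_prod_pow_mem {x : Fin ℓ → A} (hx : IsWeaklyRegular A (List.ofFn x))
    {s : A} {k : ℕ} (T : Finset (Fin ℓ)) (h : s * ∏ j ∈ T, x j ^ k ∈
      Ideal.span (Set.range fun j => x j ^ (if j ∈ T then k + 1 else 1))) :
    s ∈ Ideal.span (Set.range x) := by
  induction T using Finset.induction_on with
  | empty => simpa using h
  | insert i T hi ih =>
    refine ih ?_
    obtain ⟨w, hw⟩ := Ideal.mem_span_range_iff_exists_fun.1 h
    let e : Fin ℓ → ℕ := fun j => if j = i then k else if j ∈ T then k + 1 else 1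
    have key := mem_span_of_sum_smul_eq_zero (isWeaklyRegular_pow hx e)
      (w := fun j => if j = i then w i * x i - s * ∏ j ∈ T, x j ^ k else w j) (by
        rw [Fintype.sum_eq_add_sum_compl i] at hw ⊢
        rw [Finset.prod_insert hi, if_pos (Finset.mem_insert_self i T)] at hw
        have : ∑ j ∈ {i}ᶜ, (if j = i then w i * x i - s * ∏ j ∈ T, x j ^ k else w j) * x j ^ e j =
            ∑ j ∈ {i}ᶜ, w j * x j ^ (if j ∈ insert i T then k + 1 else 1) := by
          refine Finset.sum_congr rfl fun j hj => ?_
          have hj : j ≠ i := by simpa using hj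
          simp [e, hj]
        rw [this]
        simp only [if_true, e]
        linear_combination hw) i
    rw [if_pos rfl] at key
    have hle : Ideal.span ((fun j => x j ^ e j) '' {j | j ≠ i}) ≤
        Ideal.span (Set.range fun j => x j ^ (if j ∈ T then k + 1 else 1)) := by
      refine Ideal.span_mono ?_
      rintro _ ⟨j, hj, rfl⟩
      exact ⟨j, by simp [e, if_neg (show ¬ j = i from hj)]⟩
    have hi' : x i ∈ Ideal.span (Set.range fun j => x j ^ (if j ∈ T then k + 1 else 1)) :=
      Ideal.subset_span ⟨i, by simp [hi]⟩
    have := sub_mem (Ideal.mul_mem_left _ (w i) hi') (hle key)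
    simpa using this

theorem isParameterSequence_of_isRegular {x : List A} (hx : x ≠ []) (h : IsRegular A x) :
    IsParameterSequence A x := by
  rw [isParameterSequence_iff hx]
  refine ⟨isWeaklyProregular_of_isWeaklyRegular h.toIsWeaklyRegular, ?_, fun p _ hxp H => ?_⟩
  · intro h'
    exact h.top_ne_smul (by rw [h', smul_eq_mul, Ideal.mul_top])
  -- Already `n = 1` is contradictory: it forces `s` into the ideal of the sequence, which is
  -- contained in `p`.
  · obtain ⟨s, hs, k, hk⟩ := H 1
    refine hs (hxp ?_)
    rw [ofList_eq_span_range]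
    refine mem_span_of_mul_prod_pow_mem (k := k) (by rw [List.ofFn_get]; exact h.toIsWeaklyRegular)
      Finset.univ ?_
    simpa [Finset.prod_pow, add_comm] using hk

theorem isRegular_take {x : List A} (h : IsRegular A x) (i : ℕ) : IsRegular A (x.take i) := by
  have hx := h.toIsWeaklyRegular
  rw [← List.take_append_drop i x, isWeaklyRegular_append_iff] at hx
  refine ⟨hx.1, fun h' => h.top_ne_smul (top_le_iff.1 ?_).symm⟩
  exact h'.le.trans (Submodule.smul_mono_left (Ideal.span_mono fun a ha => List.mem_of_mem_take ha))

theorem isStrongParameterSequence_of_isRegularSequence {x : List A} (h : IsRegularSequence A x) :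
    IsStrongParameterSequence A x := by
  intro i hi hix
  rcases h with rfl | h
  · simp at hix; omega
  · refine isParameterSequence_of_isRegular ?_ (isRegular_take h i)
    rw [← List.length_pos_iff]
    simp; omega

end RegularParameter

/-! ### Perturbation by elements of square zero -/

section SquareZero

variable {A : Type u} [CommRing A]

/-- With its companion `sub_mul_add_pow_of_sq_eq_zero`, this makes powers of `z` and `z + ε`
multiples of each other at the cost of one exponent, with explicit cofactors. -/
theorem add_pow_succ_of_sq_eq_zero {z ε : A} (h : ε * ε = 0) (a : ℕ) :
    (z + ε) ^ (a + 1) = (z + (a + 1) * ε) * z ^ a := by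
  induction a with
  | zero => simp
  | succ a ih =>
    rw [pow_succ, ih]
    push_cast
    linear_combination (z ^ a * (a + 1)) * h

theorem sub_mul_add_pow_of_sq_eq_zero {z ε : A} (h : ε * ε = 0) (a : ℕ) :
    (z - a * ε) * (z + ε) ^ a = z ^ (a + 1) := by
  induction a with
  | zero => simp
  | succ a ih =>
    rw [pow_succ z, ← ih, pow_succ]
    push_cast
    linear_combination (-(z + ε) ^ a * (a + 1)) * h

/-- Factor the transition map as `K(zᵐ⁺¹) → K((z+ε)ᵐ) → K((z+ε)ⁿ⁺¹) → K(zⁿ)`. The product of the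
three multipliers is exactly `zᵐ⁺¹⁻ⁿ` because `ε² = 0`. -/
theorem koszulNull_of_sq_eq_zero {ℓ : ℕ} {z ε : Fin ℓ → A} (hε : ∀ j, ε j * ε j = 0)
    (H : ∀ n : ℕ, ∃ m, n ≤ m ∧ KoszulNull A (fun j => (z j + ε j) ^ m) (fun j => (z j + ε j) ^ n)
      (fun j => (z j + ε j) ^ (m - n))) (n : ℕ) :
    ∃ m, n ≤ m ∧ KoszulNull A (fun j => z j ^ m) (fun j => z j ^ n) (fun j => z j ^ (m - n)) := by
  obtain ⟨m, hm, h⟩ := H (n + 1)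
  refine ⟨m + 1, by omega, ?_⟩
  convert h.comp (a' := fun j => z j ^ (m + 1)) (b' := fun j => z j ^ n)
    (d := fun j => z j - m * ε j) (e := fun j => z j + (n + 1) * ε j)
    (fun j => sub_mul_add_pow_of_sq_eq_zero (hε j) m)
    (fun j => (add_pow_succ_of_sq_eq_zero (hε j) n).symm) using 2 with j
  obtain ⟨d, rfl⟩ := Nat.exists_eq_add_of_le hm
  have e1 : n + 1 + d + 1 - n = d + 1 + 1 := by omega
  have e2 : n + 1 + d - (n + 1) = d := by omega
  rw [e1, e2, pow_succ, ← sub_mul_add_pow_of_sq_eq_zero (hε j) d]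
  push_cast
  linear_combination ((z j + ε j) ^ d * (n + 1) * (n + 1 + d)) * hε j

theorem topCechVanishes_add_of_sq_eq_zero {ℓ : ℕ} {z ε : Fin ℓ → A} (hε : ∀ j, ε j * ε j = 0)
    {p : Ideal A} (H : TopCechVanishes z p) : TopCechVanishes (fun j => z j + ε j) p := by
  intro n
  -- One extra exponent pays for replacing `k` by `k + 1`, the other for passing from `z` to `z + ε`
  -- in the generators.
  obtain ⟨s, hs, k, hk⟩ := H (n + 2)
  refine ⟨s, hs, k + 1, ?_⟩
  have h1 : s * (∏ j, (z j + ε j)) ^ (k + 1) =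
      (∏ j, (z j + (k + 1) * ε j)) * (s * (∏ j, z j) ^ k) := by
    rw [← Finset.prod_pow, ← Finset.prod_pow]
    simp only [add_pow_succ_of_sq_eq_zero (hε _), Finset.prod_mul_distrib]
    ring
  rw [h1]
  refine Ideal.mul_mem_left _ _ ((Ideal.span_le.2 ?_) hk)
  rintro _ ⟨j, rfl⟩
  have h2 : z j ^ (n + 2 + k) = (z j - (n + (k + 1) : ℕ) * ε j) * (z j + ε j) ^ (n + (k + 1)) := by
    rw [sub_mul_add_pow_of_sq_eq_zero (hε j)]
    congr 1
    omega
  change z j ^ (n + 2 + k) ∈ _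
  rw [h2]
  exact Ideal.mul_mem_left _ _ (Ideal.subset_span ⟨j, rfl⟩)

theorem topCechVanishes_map {B : Type*} [CommRing B] (f : A →+* B) {ℓ : ℕ} {x : Fin ℓ → A}
    {p : Ideal A} {q : Ideal B} (hpq : ∀ s ∉ p, f s ∉ q) (H : TopCechVanishes x p) :
    TopCechVanishes (fun j => f (x j)) q := by
  intro n
  obtain ⟨s, hs, k, hk⟩ := H n
  refine ⟨f s, hpq s hs, k, ?_⟩
  have := Ideal.mem_map_of_mem f hk
  rw [Ideal.map_span, ← Set.range_comp] at this
  simpa [Function.comp_def] using this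

end SquareZero

/-! ### Sequences in the trivial extension -/

section TrivialExtension

open RingTheory.Sequence TrivSqZeroExt

variable {R : Type u} [CommRing R] {M : Type v} [AddCommGroup M] [Module R M]
  [Module Rᵐᵒᵖ M] {ℓ : ℕ}

local notation "S" => TrivSqZeroExt R M

variable (R M) in
/-- The projection `R ⋉ M → R`. -/
def fstRingHom : S →+* R where
  toFun := fst
  map_one' := fst_one
  map_mul' := fst_mul
  map_zero' := fst_zero
  map_add' := fst_add

theorem map_fstRingHom (y : List S) : y.map (fstRingHom R M) = y.map fst := rfl

theorem map_inlHom (x : List R) : x.map (inlHom R M) = x.map (inl : R → S) := rfl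

variable [IsCentralScalar R M]

theorem inl_pow_eq (r : R) (n : ℕ) : (inl r : S) ^ n = inl (r ^ n) :=
  (map_pow (inlHom R M) r n).symm

theorem sgn_smul_inl_smul (j : Fin ℓ) (s : Finset (Fin ℓ)) (r : R) (y : S) :
    sgn S j s • (inl r : S) • y = sgn R j s • r • y := by
  have h : sgn S j s = inl (sgn R j s) := by
    rw [sgn, sgn, ← inl_pow_eq, inl_neg, inl_one]
  rw [h, smul_eq_mul, smul_eq_mul, inl_mul_eq_smul, inl_mul_eq_smul]

theorem fst_koszulTotalD (x : Fin ℓ → R) (F : Finset (Fin ℓ) → S) (s : Finset (Fin ℓ)) :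
    (koszulTotalD S (fun j => (inl (x j) : S)) F s).fst =
      koszulTotalD R x (fun t => (F t).fst) s := by
  simp only [koszulTotalD_apply, sgn_smul_inl_smul, fst_sum]
  refine Finset.sum_congr rfl fun j _ => ?_
  split_ifs <;> simp

theorem snd_koszulTotalD (x : Fin ℓ → R) (F : Finset (Fin ℓ) → S) (s : Finset (Fin ℓ)) :
    (koszulTotalD S (fun j => (inl (x j) : S)) F s).snd =
      koszulTotalD M x (fun t => (F t).snd) s := by
  simp only [koszulTotalD_apply, sgn_smul_inl_smul, snd_sum]
  refine Finset.sum_congr rfl fun j _ => ?_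
  split_ifs <;> simp

theorem koszulTotalScale_inl (c : Fin ℓ → R) (F : Finset (Fin ℓ) → S) (s : Finset (Fin ℓ)) :
    koszulTotalScale (fun j => (inl (c j) : S)) F s = (∏ j ∈ s, c j) • F s := by
  have : ∏ j ∈ s, (inl (c j) : S) = inl (∏ j ∈ s, c j) := (map_prod (inlHom R M) c s).symm
  rw [koszulTotalScale, this, smul_eq_mul, inl_mul_eq_smul]

/-- Elements `inl r` act diagonally on `S = R ⊕ M`, so differential and scaling split into their
`fst` and `snd` components. -/
theorem koszulNull_inl_iff (a b c : Fin ℓ → R) :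
    KoszulNull S (fun j => (inl (a j) : S)) (fun j => inl (b j)) (fun j => inl (c j)) ↔
      KoszulNull R a b c ∧ KoszulNull M a b c := by
  constructor
  · intro H
    constructor
    · intro F hF hF0
      obtain ⟨G, hG⟩ := H (fun s => inl (F s)) (by
        ext s
        · rw [fst_koszulTotalD]
          simp [hF]
        · rw [snd_koszulTotalD]
          simp only [snd_inl]
          exact congrFun (map_zero (koszulTotalD M a)) s) (by simp [hF0])
      refine ⟨fun s => (G s).fst, ?_⟩
      ext s
      rw [← fst_koszulTotalD, hG, koszulTotalScale_inl, fst_smul, fst_inl]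
      rfl
    · intro F hF hF0
      obtain ⟨G, hG⟩ := H (fun s => inr (F s)) (by
        ext s
        · rw [fst_koszulTotalD]
          simp only [fst_inr]
          exact congrFun (map_zero (koszulTotalD R a)) s
        · rw [snd_koszulTotalD]
          simp [hF]) (by simp [hF0])
      refine ⟨fun s => (G s).snd, ?_⟩
      ext s
      rw [← snd_koszulTotalD, hG, koszulTotalScale_inl, snd_smul, snd_inr]
      rfl
  · rintro ⟨H1, H2⟩ F hF hF0
    obtain ⟨G1, hG1⟩ := H1 (fun s => (F s).fst)
      (by ext s; rw [← fst_koszulTotalD, hF]; rfl) (by simp [hF0])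
    obtain ⟨G2, hG2⟩ := H2 (fun s => (F s).snd)
      (by ext s; rw [← snd_koszulTotalD, hF]; rfl) (by simp [hF0])
    refine ⟨fun s => inl (G1 s) + inr (G2 s), ?_⟩
    ext s
    · rw [fst_koszulTotalD, koszulTotalScale_inl]
      simp only [fst_add, fst_inl, fst_inr, add_zero, hG1, fst_smul]
      rfl
    · rw [snd_koszulTotalD, koszulTotalScale_inl]
      simp only [snd_add, snd_inl, snd_inr, zero_add, hG2, snd_smul]
      rfl

/-- The domain `Fin (List.ofFn x).length` is only propositionally `Fin ℓ`; stating the equality of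
tuples in a sigma type avoids casts. -/
theorem get_ofFn_iff {A : Type*} (P : ∀ {n : ℕ}, (Fin n → A) → Prop) (x : Fin ℓ → A) :
    P (List.ofFn x).get ↔ P x :=
  iff_of_eq (congrArg (fun q : Σ n, Fin n → A => P q.2) (List.equivSigmaTuple.right_inv ⟨ℓ, x⟩))

theorem isWeaklyProregular_ofFn_iff {A : Type*} [CommRing A] {N : Type*} [AddCommGroup N]
    [Module A N] (x : Fin ℓ → A) :
    IsWeaklyProregular N (List.ofFn x) ↔ ∀ n : ℕ, ∃ m, n ≤ m ∧
      KoszulNull N (fun j => x j ^ m) (fun j => x j ^ n) (fun j => x j ^ (m - n)) := by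
  rw [isWeaklyProregular_iff]
  exact get_ofFn_iff (fun {_} x => ∀ n : ℕ, ∃ m, n ≤ m ∧
      KoszulNull N (fun j => x j ^ m) (fun j => x j ^ n) (fun j => x j ^ (m - n))) x

theorem koszulNull_mono {A : Type*} [CommRing A] {N : Type*} [AddCommGroup N] [Module A N]
    {x : Fin ℓ → A} {n m m' : ℕ} (hn : n ≤ m) (hm : m ≤ m')
    (h : KoszulNull N (fun j => x j ^ m) (fun j => x j ^ n) (fun j => x j ^ (m - n))) :
    KoszulNull N (fun j => x j ^ m') (fun j => x j ^ n) (fun j => x j ^ (m' - n)) := by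
  convert h.comp (a' := fun j => x j ^ m') (b' := fun j => x j ^ n) (d := fun j => x j ^ (m' - m))
    (e := fun _ => 1) (fun j => pow_sub_mul_pow _ hm) (fun j => one_mul _) using 2 with j
  rw [one_mul, ← pow_add]
  congr 1
  omega

theorem isWeaklyProregular_map_inl_iff (x : List R) :
    IsWeaklyProregular S (x.map (inl : R → S)) ↔
      IsWeaklyProregular R x ∧ IsWeaklyProregular M x := by
  obtain ⟨ℓ, x, rfl⟩ : ∃ (ℓ : ℕ) (x' : Fin ℓ → R), x = List.ofFn x' :=
    ⟨_, x.get, (List.ofFn_get x).symm⟩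
  rw [List.map_ofFn]
  simp only [isWeaklyProregular_ofFn_iff, Function.comp_def, inl_pow_eq, koszulNull_inl_iff]
  refine ⟨fun H => ⟨fun n => ?_, fun n => ?_⟩, fun ⟨H1, H2⟩ n => ?_⟩
  · obtain ⟨m, hm, h⟩ := H n
    exact ⟨m, hm, h.1⟩
  · obtain ⟨m, hm, h⟩ := H n
    exact ⟨m, hm, h.2⟩
  · obtain ⟨m₁, hm₁, h₁⟩ := H1 n
    obtain ⟨m₂, hm₂, h₂⟩ := H2 n
    exact ⟨max m₁ m₂, le_max_of_le_left hm₁, koszulNull_mono hm₁ (le_max_left _ _) h₁,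
      koszulNull_mono hm₂ (le_max_right _ _) h₂⟩

theorem isWeaklyProregular_map_fst {y : List S} (hy : IsWeaklyProregular S y) :
    IsWeaklyProregular R (y.map fst) := by
  suffices H : IsWeaklyProregular S ((y.map fst).map (inl : R → S)) from
    ((isWeaklyProregular_map_inl_iff _).1 H).1
  obtain ⟨ℓ, y, rfl⟩ : ∃ (ℓ : ℕ) (y' : Fin ℓ → S), y = List.ofFn y' :=
    ⟨_, y.get, (List.ofFn_get y).symm⟩
  rw [List.map_ofFn, List.map_ofFn]
  rw [isWeaklyProregular_ofFn_iff] at hy ⊢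
  refine koszulNull_of_sq_eq_zero (ε := fun j => inr (y j).snd)
    (fun j => inr_mul_inr R _ _) ?_
  simpa only [Function.comp_def, inl_fst_add_inr_snd_eq] using hy

theorem ofList_map_fst_eq_top_iff (y : List S) :
    Ideal.ofList (y.map fst) = ⊤ ↔ Ideal.ofList y = ⊤ := by
  have h : Ideal.ofList (y.map fst) = (Ideal.ofList y).map (fstRingHom R M) := by
    rw [Ideal.map_ofList, map_fstRingHom]
  rw [h]
  constructor
  · intro h1
    rw [Ideal.eq_top_iff_one, Ideal.mem_map_iff_of_surjective _
      (fun r => ⟨inl r, fst_inl M r⟩)] at h1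
    obtain ⟨a, ha, h1⟩ := h1
    exact Ideal.eq_top_of_isUnit_mem _ ha (isUnit_iff_isUnit_fst.2 (by
      change IsUnit (fstRingHom R M a)
      rw [h1]
      exact isUnit_one))
  · intro h1
    rw [h1, Ideal.map_top]

theorem isParameterSequence_map_fst {y : List S} (hy0 : y ≠ []) (hy : IsParameterSequence S y) :
    IsParameterSequence R (y.map fst) := by
  rw [isParameterSequence_iff hy0] at hy
  rw [isParameterSequence_iff (by simpa using hy0)]
  refine ⟨isWeaklyProregular_map_fst hy.1, mt (ofList_map_fst_eq_top_iff y).1 hy.2.1,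
    fun p hp hyp H => ?_⟩
  refine hy.2.2 (p.comap (fstRingHom R M)) (hp.comap _) ?_ ?_
  · rw [← Ideal.map_le_iff_le_comap, Ideal.map_ofList, map_fstRingHom]
    exact hyp
  · clear hyp hy hy0
    obtain ⟨ℓ, y, rfl⟩ : ∃ (ℓ : ℕ) (y' : Fin ℓ → S), y = List.ofFn y' :=
      ⟨_, y.get, (List.ofFn_get y).symm⟩
    rw [List.map_ofFn] at H
    refine (get_ofFn_iff (fun {_} y => TopCechVanishes y _) y).2 ?_
    have H := (get_ofFn_iff (fun {_} y => TopCechVanishes y p) (fst ∘ y)).1 H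
    have := topCechVanishes_add_of_sq_eq_zero (ε := fun j => inr (y j).snd)
      (fun j => inr_mul_inr R _ _) (topCechVanishes_map (inlHom R M)
        (q := p.comap (fstRingHom R M)) (fun s hs => hs) H)
    convert this using 2 with j
    exact (inl_fst_add_inr_snd_eq _).symm

theorem isParameterSequence_map_inl {x : List R} (hx0 : x ≠ []) (hx : IsParameterSequence R x)
    (hxM : IsWeaklyProregular M x) : IsParameterSequence S (x.map (inl : R → S)) := by
  rw [isParameterSequence_iff hx0] at hx
  rw [isParameterSequence_iff (by simpa using hx0)]
  refine ⟨(isWeaklyProregular_map_inl_iff x).2 ⟨hx.1, hxM⟩, ?_, fun p hp hxp H => ?_⟩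
  · rw [Ne, ← ofList_map_fst_eq_top_iff, List.map_map]
    simpa [Function.comp_def] using hx.2.1
  · refine hx.2.2 (p.comap (inlHom R M)) (hp.comap _) ?_ ?_
    · rw [← Ideal.map_le_iff_le_comap, Ideal.map_ofList, map_inlHom]
      exact hxp
    · clear hxp hx hx0
      obtain ⟨ℓ, x, rfl⟩ : ∃ (ℓ : ℕ) (x' : Fin ℓ → R), x = List.ofFn x' :=
        ⟨_, x.get, (List.ofFn_get x).symm⟩
      rw [List.map_ofFn] at H
      refine (get_ofFn_iff (fun {_} y => TopCechVanishes y _) x).2 ?_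
      have H := (get_ofFn_iff (fun {_} y => TopCechVanishes y p) (inl ∘ x)).1 H
      refine topCechVanishes_map (fstRingHom R M) (x := inl ∘ x) (p := p)
        (q := p.comap (inlHom R M)) (fun s hs h => hs ?_) H
      -- The prime `p` contains the square-zero part of `s`, so `s ∉ p` is decided by `s.fst` alone.
      have h1 : (inr s.snd : S) ∈ p :=
        hp.mem_of_pow_mem 2 (by rw [pow_two, inr_mul_inr]; exact zero_mem p)
      have h2 : (inl s.fst : S) ∈ p := h
      rw [← inl_fst_add_inr_snd_eq s]
      exact add_mem h2 h1

theorem isStrongParameterSequence_map_fst {y : List S} (hy : IsStrongParameterSequence S y) :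
    IsStrongParameterSequence R (y.map fst) := by
  intro i hi hiy
  rw [List.length_map] at hiy
  rw [← List.map_take]
  refine isParameterSequence_map_fst ?_ (hy i hi hiy)
  rw [← List.length_pos_iff, List.length_take]
  omega

theorem isStrongParameterSequence_map_inl
    (H : ∀ x : List R, IsWeaklyProregular R x → IsWeaklyProregular M x) {x : List R}
    (hx : IsStrongParameterSequence R x) :
    IsStrongParameterSequence S (x.map (inl : R → S)) := by
  intro i hi hix
  rw [List.length_map] at hix
  rw [← List.map_take]
  refine isParameterSequence_map_inl ?_ (hx i hi hix) (H _ (hx i hi hix).weaklyProregular)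
  rw [← List.length_pos_iff, List.length_take]
  omega

/-- Regard `R` and `M` as `S`-modules through `fst`; then `0 → M → S → R → 0` is exact over `S`, and
an entry of `y` acts on both ends through its `fst`. -/
theorem isWeaklyRegular_of_map_fst {y : List S} (hR : IsWeaklyRegular R (y.map fst))
    (hM : IsWeaklyRegular M (y.map fst)) : IsWeaklyRegular S y := by
  let : Algebra S R := (fstRingHom R M).toAlgebra
  let : Module S M := Module.compHom M (fstRingHom R M)
  have : IsScalarTower S R M := ⟨fun s r m => mul_smul s.fst r m⟩
  have hR' : IsWeaklyRegular R y := (isWeaklyRegular_map_algebraMap_iff R R y).1 hR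
  have hM' : IsWeaklyRegular M y := (isWeaklyRegular_map_algebraMap_iff R M y).1 hM
  let f : M →ₗ[S] S :=
    { toFun := inr
      map_add' := inr_add R
      map_smul' := fun s m => by
        change inr (s.fst • m) = s * inr m
        ext <;> simp }
  let g : S →ₗ[S] R :=
    { toFun := fst
      map_add' := fst_add
      map_smul' := fun s t => fst_mul s t }
  refine isWeaklyRegular_of_exact (f := f) (g := g) inr_injective (fun s => ?_)
    (fun r => ⟨inl r, fst_inl M r⟩) hM' hR'
  constructor
  · intro h
    exact ⟨s.snd, TrivSqZeroExt.ext (Eq.symm h) rfl⟩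
  · rintro ⟨m, rfl⟩
    rfl

theorem isWeaklyRegular_of_map_inl {x : List R} (h : IsWeaklyRegular S (x.map (inl : R → S))) :
    IsWeaklyRegular R x ∧ IsWeaklyRegular M x := by
  have h' : IsWeaklyRegular S x := (isWeaklyRegular_map_algebraMap_iff S S x).1 h
  exact ⟨isWeaklyRegular_of_retract (f := (Algebra.linearMap R S))
      (g := (fstHom R R M).toLinearMap) (LinearMap.ext fun r => rfl) h',
    isWeaklyRegular_of_retract (f := inrHom R M) (g := sndHom R M) (LinearMap.ext fun r => rfl) h'⟩

theorem isCohenMacaulayRing_trivSqZeroExt (hR : IsCohenMacaulayRing R)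
    (hM : ∀ x : List R, IsRegularSequence R x → IsWeaklyRegular M x) : IsCohenMacaulayRing S := by
  intro y hy
  rcases eq_or_ne y [] with rfl | hy0
  · exact .inl rfl
  have hreg := hR _ (isStrongParameterSequence_map_fst hy)
  have hwM := hM _ hreg
  have hpos := List.length_pos_iff.2 hy0
  have htop := (hy y.length hpos le_rfl).smul_top_ne
  rw [List.take_length] at htop
  -- Properness comes from the parameter sequence `y` itself, which is why weak regularity on `M`
  -- suffices.
  exact .inr ⟨isWeaklyRegular_of_map_fst
    ((hreg.resolve_left (by simpa using hy0)).toIsWeaklyRegular) hwM, htop.symm⟩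

/-- Serves both halves of the necessary condition: the first conclusion is that `R` is
Cohen–Macaulay, and the second applies to `R`-regular sequences because they are strong parameter
sequences. -/
theorem isRegularSequence_of_isCohenMacaulayRing_trivSqZeroExt (hS : IsCohenMacaulayRing S)
    (H : ∀ x : List R, IsWeaklyProregular R x → IsWeaklyProregular M x) {x : List R}
    (hx : IsStrongParameterSequence R x) : IsRegularSequence R x ∧ IsWeaklyRegular M x := by
  rcases eq_or_ne x [] with rfl | hx0
  · exact ⟨.inl rfl, .nil R M⟩
  have hreg := (hS _ (isStrongParameterSequence_map_inl H hx)).resolve_left (by simpa using hx0)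
  have hw := isWeaklyRegular_of_map_inl hreg.toIsWeaklyRegular
  have hpos := List.length_pos_iff.2 hx0
  have htop := (hx x.length hpos le_rfl).smul_top_ne
  rw [List.take_length] at htop
  exact ⟨.inr ⟨hw.1, htop.symm⟩, hw.2⟩

end TrivialExtension

end HamiltonMarley

end

/-- The trivial extension `R ⋉ M` is `TrivSqZeroExt R M`; the right action of `R` on `M` that its
ring structure mentions is the given one, by `IsCentralScalar R M`. -/
theorem mainTheorem1 {R : Type u} [CommRing R] {M : Type v} [AddCommGroup M] [Module R M]
    [Module Rᵐᵒᵖ M] [IsCentralScalar R M] :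
    ((∀ x : List R,
        HamiltonMarley.IsWeaklyProregular R x → HamiltonMarley.IsWeaklyProregular M x) →
      (HamiltonMarley.IsCohenMacaulayRing (TrivSqZeroExt R M) ↔
        HamiltonMarley.IsCohenMacaulayRing R ∧
          ∀ x : List R, HamiltonMarley.IsRegularSequence R x →
            RingTheory.Sequence.IsWeaklyRegular M x)) ∧
    ((HamiltonMarley.IsCohenMacaulayRing R ∧
        ∀ x : List R, HamiltonMarley.IsRegularSequence R x →
          RingTheory.Sequence.IsWeaklyRegular M x) →
      HamiltonMarley.IsCohenMacaulayRing (TrivSqZeroExt R M)) := by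
  refine ⟨fun H => ⟨fun hS => ⟨fun x hx => ?_, fun x hx => ?_⟩, fun h => ?_⟩, fun h => ?_⟩
  · exact (HamiltonMarley.isRegularSequence_of_isCohenMacaulayRing_trivSqZeroExt hS H hx).1
  · exact (HamiltonMarley.isRegularSequence_of_isCohenMacaulayRing_trivSqZeroExt hS H
      (HamiltonMarley.isStrongParameterSequence_of_isRegularSequence hx)).2
  · exact HamiltonMarley.isCohenMacaulayRing_trivSqZeroExt h.1 h.2
  · exact HamiltonMarley.isCohenMacaulayRing_trivSqZeroExt h.1 h.2
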